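/- Let $\mathcal{E}$ be a Grothendieck topos (a category equivalent to the category of sheaves of sets on a small site) and let $X$ be an object of $\mathcal{E}$. Write $1$ for the terminal object, $\Omega$ for the subobject classifier and $2 = 1+1$. Call $X$ (a) \emph{locally finite} if there are a family $(U_i)_{i\in I}$ of objects, indexed by a set, for which $\sum_{i} U_i \to 1$ is an epimorphism, and natural numbers $n_i \ge 0$ such that, for every $i\in I$, $X\times U_i$ and $\bigl(\sum_{k=1}^{n_i} 1\bigr)\times U_i$ are isomorphic in $\mathcal{E}/U_i$; (b) \emph{decidable} if the diagonal $X \rightarrowtail X\times X$ is a complemented subobject; (c) \emph{Kuratowski-finite} if the least subobject of $\Omega^X$ that contains the bottom element, is closed under binary joins, and contains the image of the singleton map $\{\}: X\to\Omega^X$ (the transpose of the characteristic map of the diagonal) contains the top element of $\Omega^X$. Then: (1) $X$ is locally finite if and only if $X$ is decidable and Kuratowski-finite. (2) If $X$ is decidable, there is a unique map of monoids $\kappa_X : (X^*,\cdot)\to(2^X,\vee)$ from the free monoid $X^* = \sum_{n\ge 0} X^n$ (with concatenation) that extends the singleton map, i.e. such that the composite $X\to X^*\to 2^X\to\Omega^X$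 is $\{\}$, where $2^X\to\Omega^X$ is induced by $(\top,\bot):1+1\to\Omega$. (3) $X$ is decidable and Kuratowski-finite if and only if such a map of monoids $\kappa_X$ exists and is an epimorphism. -/

import Mathlib

open CategoryTheory Limits MonoidalCategory CartesianMonoidalCategory MonoidalClosed

universe w u

/-! ## Grothendieck toposes -/

/-- A category is a Grothendieck topos if it is equivalent to the category of sheaves of sets on
some small site. -/
class IsGrothendieckTopos (E : Type u) [Category.{w} E] : Prop where
  exists_site : ∃ (C : Type w) (_ : SmallCategory C) (J : GrothendieckTopology C),
    Nonempty (E ≌ Sheaf J (Type w))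

namespace IsGrothendieckTopos

/-! The standard structure of a Grothendieck topos: limits, colimits, images, finite products,
exponentials and a subobject classifier, all derived from the defining equivalence. -/

section Structure

variable (E : Type u) [Category.{w} E] [IsGrothendieckTopos.{w} E]

instance hasLimits : HasLimitsOfSize.{w, w} E := by
  obtain ⟨C, _, J, ⟨e⟩⟩ := IsGrothendieckTopos.exists_site (E := E)
  exact Adjunction.has_limits_of_equivalence e.functor

instance hasColimits : HasColimitsOfSize.{w, w} E := by
  obtain ⟨C, _, J, ⟨e⟩⟩ := IsGrothendieckTopos.exists_site (E := E)
  have : HasColimitsOfSize.{w, w} (Sheaf J (Type w)) :=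
    ⟨fun K _ => CategoryTheory.Sheaf.instHasColimitsOfShape⟩
  exact Adjunction.has_colimits_of_equivalence e.functor

instance hasFiniteLimits : HasFiniteLimits E := hasFiniteLimits_of_hasLimits E

instance hasFiniteColimits : HasFiniteColimits E := hasFiniteColimits_of_hasColimits E

instance hasCoproductsOfShapeNat : HasCoproductsOfShape ℕ E :=
  hasColimitsOfShape_of_equivalence (Discrete.equivalence (Equiv.ulift.{w} (α := ℕ)))

instance hasStrongEpiMonoFactorisations : HasStrongEpiMonoFactorisations E := by
  obtain ⟨C, _, J, ⟨e⟩⟩ := IsGrothendieckTopos.exists_site (E := E)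
  have : HasStrongEpiMonoFactorisations (Sheaf J (Type w)) :=
    ⟨fun f => ⟨{ Image.monoFactorisation f with e_strong_epi := inferInstanceAs
      (StrongEpi (factorThruImage f)) }⟩⟩
  exact e.inverse.hasStrongEpiMonoFactorisations_imp_of_isEquivalence

instance hasSubobjectClassifier : HasSubobjectClassifier E := by
  obtain ⟨C, _, J, ⟨e⟩⟩ := IsGrothendieckTopos.exists_site (E := E)
  exact ⟨⟨(HasSubobjectClassifier.exists_classifier
    (C := Sheaf J (Type w))).some.ofEquivalence e.symm⟩⟩

noncomputable instance cartesianMonoidalCategory : CartesianMonoidalCategory E :=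
  .ofHasFiniteProducts

variable {E} in
/-- Exponentials transported along an equivalence with a category of sheaves. -/
noncomputable abbrev monoidalClosedOfEquiv {C : Type w} [SmallCategory C]
    (J : GrothendieckTopology C) (e : E ≌ Sheaf J (Type w)) : MonoidalClosed E :=
  let h : MonoidalClosed (Sheaf J (Type w)) := inferInstance
  @cartesianClosedOfEquiv _ _ _ _ _ _ e.symm h

noncomputable instance monoidalClosed : MonoidalClosed E :=
  have h := IsGrothendieckTopos.exists_site (E := E)
  letI := h.choose_spec.choose
  monoidalClosedOfEquiv h.choose_spec.choose_spec.choose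
    h.choose_spec.choose_spec.choose_spec.some

instance initialMonoClass : InitialMonoClass E :=
  InitialMonoClass.of_initial fun X => CategoryTheory.Initial.mono_to X

instance wellPowered : WellPowered.{w} E where
  subobject_small X := by
    have r := (HasSubobjectClassifier.exists_classifier (C := E)).some.representableBy
    exact small_of_injective (r.homEquiv (X := X)).symm.injective

end Structure

end IsGrothendieckTopos

namespace ToposFinite

variable {E : Type u} [Category.{w} E]

/-! ## Locally finite objects -/

section LocallyFinite

variable [CartesianMonoidalCategory E] [HasColimitsOfSize.{w, w} E]

/-- A family of objects covers the terminal object if the induced map from its sum to the terminal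
object is an epimorphism. -/
def IsCover {I : Type w} (U : I → E) : Prop :=
  Epi (Sigma.desc fun i => toUnit (U i))

/-- The constant object on a set `S`, the sum of `S` copies of the terminal object. This is the
value at `S` of the inverse image functor of the unique geometric morphism to sets. -/
noncomputable def constantObj (S : Type w) : E :=
  ∐ fun _ : S => 𝟙_ E

/-- `X` is locally finite if there is a cover `U` of the terminal object such that, for each `i`,
`X × U i` and the product of `U i` with a constant finite set are isomorphic over `U i`. -/
def IsLocallyFinite (X : E) : Prop :=
  ∃ (I : Type w) (U : I → E), IsCover U ∧ ∀ i, ∃ n : ℕ,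
    Nonempty (Over.mk (snd X (U i)) ≅ Over.mk (snd (constantObj (ULift.{w} (Fin n))) (U i)))

end LocallyFinite

/-! ## Decidable objects -/

section Diagonal

variable [CartesianMonoidalCategory E]

instance mono_lift_id (X : E) : Mono (lift (𝟙 X) (𝟙 X)) :=
  mono_of_mono_fac (lift_fst (𝟙 X) (𝟙 X))

/-- The diagonal of `X`, as a subobject of `X × X`. -/
noncomputable def diagonal (X : E) : Subobject (X ⊗ X) :=
  Subobject.mk (lift (𝟙 X) (𝟙 X))

/-- `X` is decidable if its diagonal has a complement in the lattice of subobjects of `X × X`. -/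
def IsDecidable [HasPullbacks E] [HasImages E] [HasFiniteColimits E] [InitialMonoClass E]
    (X : E) : Prop :=
  IsComplemented (diagonal X)

end Diagonal

/-! ## Exponentials of monoids -/

section Power

variable [CartesianMonoidalCategory E] [MonoidalClosed E]

/-- The exponential object `A ^ X`. -/
noncomputable abbrev pow (A X : E) : E := (ihom X).obj A

/-- The evaluation map `X × A ^ X ⟶ A`. -/
noncomputable abbrev eval (A X : E) : X ⊗ pow A X ⟶ A := (ihom.ev X).app A

/-- The constant global element of `A ^ X` on a global element of `A`. -/
noncomputable def powConst {A : E} (X : E) (a : 𝟙_ E ⟶ A) : 𝟙_ E ⟶ pow A X :=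
  curry (toUnit _ ≫ a)

/-- The pointwise extension to `A ^ X` of a binary operation on `A`. -/
noncomputable def powMul {A : E} (X : E) (m : A ⊗ A ⟶ A) : pow A X ⊗ pow A X ⟶ pow A X :=
  curry (lift (X ◁ fst _ _ ≫ eval A X) (X ◁ snd _ _ ≫ eval A X) ≫ m)

lemma comp_powMul {A X T : E} (m : A ⊗ A ⟶ A) (f : T ⟶ pow A X ⊗ pow A X) :
    f ≫ powMul X m =
      curry (lift (uncurry (f ≫ fst _ _)) (uncurry (f ≫ snd _ _)) ≫ m) := by
  rw [powMul, ← curry_natural_left, ← Category.assoc, comp_lift, ← whiskerLeft_comp_assoc,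
    ← whiskerLeft_comp_assoc, uncurry_eq, uncurry_eq]

lemma comp_powConst {A X T : E} (a : 𝟙_ E ⟶ A) (f : T ⟶ 𝟙_ E) :
    f ≫ powConst X a = curry (toUnit _ ≫ a) := by
  rw [powConst, ← curry_natural_left, ← Category.assoc]
  congr 2
  exact toUnit_unique _ _

/-- The pointwise monoid structure on `A ^ X` for a monoid `A`. -/
noncomputable instance monObjPow (A X : E) [MonObj A] : MonObj (pow A X) where
  one := powConst X MonObj.one
  mul := powMul X MonObj.mul
  one_mul := by
    rw [comp_powMul, whiskerRight_fst, whiskerRight_snd, comp_powConst, uncurry_curry,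
      curry_eq_iff, leftUnitor_hom]
    exact MonObj.lift_comp_one_left _ _
  mul_one := by
    rw [comp_powMul, whiskerLeft_fst, whiskerLeft_snd, comp_powConst, uncurry_curry,
      curry_eq_iff, rightUnitor_hom]
    exact MonObj.lift_comp_one_right _ _
  mul_assoc := by
    rw [comp_powMul, whiskerRight_fst, whiskerRight_snd, comp_powMul, uncurry_curry]
    conv_rhs => rw [← Category.assoc]
    rw [comp_powMul, Category.assoc, Category.assoc, whiskerLeft_fst, whiskerLeft_snd,
      ← Category.assoc _ _ (powMul X _), comp_powMul, uncurry_curry]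
    congr 1
    simp [MonObj.lift_lift_assoc]

end Power

/-! ## Power objects and Kuratowski-finiteness -/

section Kuratowski

open HasSubobjectClassifier

section Classifier

variable [HasSubobjectClassifier E]

/-- The characteristic map of a subobject. -/
noncomputable def char {X : E} (S : Subobject X) : X ⟶ Ω E := χ S.arrow

variable [CartesianMonoidalCategory E]

/-- The global element `⊤` of `Ω`. -/
noncomputable def omegaTop : 𝟙_ E ⟶ Ω E := char ⊤

/-- The global element `⊥` of `Ω`. -/
noncomputable def omegaBot [HasInitial E] [InitialMonoClass E] : 𝟙_ E ⟶ Ω E := char ⊥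

/-- The join `∨ : Ω × Ω ⟶ Ω`, classifying the union of `{⊤} × Ω` and `Ω × {⊤}`. -/
noncomputable def omegaJoin [HasPullbacks E] [HasImages E] [HasBinaryCoproducts E] :
    Ω E ⊗ Ω E ⟶ Ω E :=
  char ((Subobject.pullback (fst _ _)).obj (Subobject.mk (truth E)) ⊔
    (Subobject.pullback (snd _ _)).obj (Subobject.mk (truth E)))

end Classifier

variable [CartesianMonoidalCategory E] [MonoidalClosed E] [HasSubobjectClassifier E]

/-- The singleton map `X ⟶ Ω ^ X`, the transpose of the characteristic map of the diagonal. -/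
noncomputable def singleton (X : E) : X ⟶ pow (Ω E) X := curry (char (diagonal X))

section Submonoid

variable [HasPullbacks E] [HasImages E] [HasFiniteColimits E] [InitialMonoClass E]

/-- A subobject of `Ω ^ X` is a join-submonoid if it contains the bottom element and is closed
under binary joins. -/
structure IsJoinSubmonoid {X : E} (S : Subobject (pow (Ω E) X)) : Prop where
  bot_mem : S.Factors (powConst X omegaBot)
  join_mem : S.Factors ((S.arrow ⊗ₘ S.arrow) ≫ powMul X omegaJoin)

/-- The least join-submonoid of `Ω ^ X` containing the image of the singleton map. -/
noncomputable def finitePowerObj [WellPowered.{w} E] [HasWidePullbacks.{w} E] (X : E) :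
    Subobject (pow (Ω E) X) :=
  Subobject.sInf.{w} {S | IsJoinSubmonoid S ∧ S.Factors (singleton X)}

/-- `X` is Kuratowski-finite if the least join-submonoid of `Ω ^ X` containing the singletons
contains the top element of `Ω ^ X`. -/
def IsKuratowskiFinite [WellPowered.{w} E] [HasWidePullbacks.{w} E] (X : E) : Prop :=
  (finitePowerObj X).Factors (powConst X omegaTop)

end Submonoid

end Kuratowski

/-! ## Sums in a cartesian closed category distribute over products -/

section Distributivity

variable [CartesianMonoidalCategory E]

lemma swap_swap_assoc {A Y Z : E} (f : A ⊗ Y ⟶ Z) :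
    lift (snd A Y) (fst A Y) ≫ lift (snd Y A) (fst Y A) ≫ f = f := by
  rw [← Category.assoc]
  convert Category.id_comp f
  ext <;> simp

variable [MonoidalClosed E]

/-- Currying in the left-hand factor. -/
noncomputable def curryLeft {A Y Z : E} (f : A ⊗ Y ⟶ Z) : A ⟶ (ihom Y).obj Z :=
  curry (lift (snd Y A) (fst Y A) ≫ f)

/-- Uncurrying in the left-hand factor. -/
noncomputable def uncurryLeft {A Y Z : E} (f : A ⟶ (ihom Y).obj Z) : A ⊗ Y ⟶ Z :=
  lift (snd A Y) (fst A Y) ≫ uncurry f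

lemma uncurryLeft_curryLeft {A Y Z : E} (f : A ⊗ Y ⟶ Z) : uncurryLeft (curryLeft f) = f := by
  rw [uncurryLeft, curryLeft, uncurry_curry, swap_swap_assoc]

lemma curryLeft_injective {A Y Z : E} {f g : A ⊗ Y ⟶ Z} (h : curryLeft f = curryLeft g) :
    f = g := by
  rw [← uncurryLeft_curryLeft f, h, uncurryLeft_curryLeft]

lemma whiskerRight_uncurryLeft {A B Y Z : E} (i : A ⟶ B) (h : B ⟶ (ihom Y).obj Z) :
    i ▷ Y ≫ uncurryLeft h = uncurryLeft (i ≫ h) := by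
  rw [uncurryLeft, uncurryLeft, uncurry_natural_left, ← Category.assoc, ← Category.assoc]
  congr 1
  ext <;> simp

lemma comp_curryLeft {A B Y Z : E} (i : A ⟶ B) (f : B ⊗ Y ⟶ Z) :
    i ≫ curryLeft f = curryLeft (i ▷ Y ≫ f) := by
  rw [curryLeft, curryLeft, ← curry_natural_left, ← Category.assoc, ← Category.assoc]
  congr 2
  ext <;> simp

/-- The map out of `(A + B) × Y` given by a map on each of the two summands. -/
noncomputable def coprodTensorDesc {A B Y Z : E} [HasBinaryCoproduct A B]
    (f : A ⊗ Y ⟶ Z) (g : B ⊗ Y ⟶ Z) : (A ⨿ B) ⊗ Y ⟶ Z :=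
  uncurryLeft (coprod.desc (curryLeft f) (curryLeft g))

lemma inl_coprodTensorDesc {A B Y Z : E} [HasBinaryCoproduct A B]
    (f : A ⊗ Y ⟶ Z) (g : B ⊗ Y ⟶ Z) : coprod.inl ▷ Y ≫ coprodTensorDesc f g = f := by
  rw [coprodTensorDesc, whiskerRight_uncurryLeft, coprod.inl_desc, uncurryLeft_curryLeft]

lemma inr_coprodTensorDesc {A B Y Z : E} [HasBinaryCoproduct A B]
    (f : A ⊗ Y ⟶ Z) (g : B ⊗ Y ⟶ Z) : coprod.inr ▷ Y ≫ coprodTensorDesc f g = g := by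
  rw [coprodTensorDesc, whiskerRight_uncurryLeft, coprod.inr_desc, uncurryLeft_curryLeft]

lemma coprodTensor_ext {A B Y Z : E} [HasBinaryCoproduct A B] {f g : (A ⨿ B) ⊗ Y ⟶ Z}
    (hl : coprod.inl ▷ Y ≫ f = coprod.inl ▷ Y ≫ g)
    (hr : coprod.inr ▷ Y ≫ f = coprod.inr ▷ Y ≫ g) : f = g := by
  apply curryLeft_injective
  apply coprod.hom_ext
  · rw [comp_curryLeft, comp_curryLeft, hl]
  · rw [comp_curryLeft, comp_curryLeft, hr]

/-- The map out of `(∑ i, A i) × Y` given by a map on each of the summands. -/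
noncomputable def sigmaTensorDesc {I : Type} {A : I → E} [HasCoproduct A] {Y Z : E}
    (f : ∀ i, A i ⊗ Y ⟶ Z) : (∐ A) ⊗ Y ⟶ Z :=
  uncurryLeft (Sigma.desc fun i => curryLeft (f i))

lemma ι_sigmaTensorDesc {I : Type} {A : I → E} [HasCoproduct A] {Y Z : E}
    (f : ∀ i, A i ⊗ Y ⟶ Z) (i : I) : Sigma.ι A i ▷ Y ≫ sigmaTensorDesc f = f i := by
  rw [sigmaTensorDesc, whiskerRight_uncurryLeft, Sigma.ι_desc, uncurryLeft_curryLeft]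

lemma sigmaTensor_ext {I : Type} {A : I → E} [HasCoproduct A] {Y Z : E} {f g : (∐ A) ⊗ Y ⟶ Z}
    (h : ∀ i, Sigma.ι A i ▷ Y ≫ f = Sigma.ι A i ▷ Y ≫ g) : f = g := by
  apply curryLeft_injective
  apply Sigma.hom_ext
  intro i
  rw [comp_curryLeft, comp_curryLeft, h]

lemma tensorSigma_ext {I : Type} {A : I → E} [HasCoproduct A] {Y Z : E} {f g : Y ⊗ (∐ A) ⟶ Z}
    (h : ∀ i, Y ◁ Sigma.ι A i ≫ f = Y ◁ Sigma.ι A i ≫ g) : f = g := by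
  apply curry_injective
  apply Sigma.hom_ext
  intro i
  rw [← curry_natural_left, ← curry_natural_left, h]

end Distributivity

/-! ## The complemented power object -/

section ComplementedPower

variable [CartesianMonoidalCategory E] [HasFiniteCoproducts E]

variable (E) in
/-- The complemented subobject classifier `2 = 1 + 1`; the first summand is `⊤`, the second one
is `⊥`. -/
noncomputable abbrev two : E := 𝟙_ E ⨿ 𝟙_ E

/-- The map `(⊤, ⊥) : 1 + 1 ⟶ Ω`. -/
noncomputable def twoToOmega [HasSubobjectClassifier E] [InitialMonoClass E] :
    two E ⟶ HasSubobjectClassifier.Ω E :=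
  coprod.desc omegaTop omegaBot

variable [MonoidalClosed E]

/-- The inclusion `2 ^ X ⟶ Ω ^ X`. -/
noncomputable def powTwoToPowOmega [HasSubobjectClassifier E] [InitialMonoClass E] (X : E) :
    pow (two E) X ⟶ pow (HasSubobjectClassifier.Ω E) X :=
  (ihom X).map twoToOmega

/-- The join `∨ : 2 × 2 ⟶ 2`, with `⊤ ∨ y = ⊤` and `⊥ ∨ y = y`. -/
noncomputable def twoJoin : two E ⊗ two E ⟶ two E :=
  coprodTensorDesc (toUnit _ ≫ coprod.inl) (snd _ _)

lemma inl_twoJoin : coprod.inl ▷ _ ≫ twoJoin = toUnit (𝟙_ E ⊗ two E) ≫ coprod.inl :=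
  inl_coprodTensorDesc _ _

lemma inr_twoJoin : coprod.inr ▷ _ ≫ twoJoin = snd (𝟙_ E) (two E) :=
  inr_coprodTensorDesc _ _

/-- The monoid `(2, ∨)`, with unit `⊥`. -/
noncomputable instance monObjTwo : MonObj (two E) where
  one := coprod.inr
  mul := twoJoin
  one_mul := inr_twoJoin.trans (leftUnitor_hom _).symm
  mul_one := by
    apply coprodTensor_ext
    · rw [← whisker_exchange_assoc, inl_twoJoin, rightUnitor_hom, whiskerRight_fst,
        ← Category.assoc]
      congr 1
      exact toUnit_unique _ _
    · rw [← whisker_exchange_assoc, inr_twoJoin, rightUnitor_hom, whiskerRight_fst,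
        whiskerLeft_snd]
      congr 1
      exact toUnit_unique _ _
  mul_assoc := by
    have key (f : 𝟙_ E ⟶ two E) : f ▷ two E ▷ two E ≫ (α_ _ _ _).hom =
        (α_ _ _ _).hom ≫ f ▷ (two E ⊗ two E) := by simp
    have h : ∀ {f g : (two E ⊗ two E) ⊗ two E ⟶ two E},
        coprod.inl ▷ two E ▷ two E ≫ f = coprod.inl ▷ two E ▷ two E ≫ g →
        coprod.inr ▷ two E ▷ two E ≫ f = coprod.inr ▷ two E ▷ two E ≫ g → f = g := by
      intro f g hl hr
      rw [← cancel_epi (α_ _ _ _).inv]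
      apply coprodTensor_ext
      · simpa using congrArg (fun k => (α_ _ _ _).inv ≫ k) hl
      · simpa using congrArg (fun k => (α_ _ _ _).inv ≫ k) hr
    apply h
    · rw [← comp_whiskerRight_assoc, inl_twoJoin, ← Category.assoc, key, Category.assoc,
        ← whisker_exchange_assoc, inl_twoJoin, comp_whiskerRight_assoc, inl_twoJoin]
      simp only [← Category.assoc]
      congr 1
      exact toUnit_unique _ _
    · rw [← comp_whiskerRight_assoc, inr_twoJoin, ← Category.assoc, key, Category.assoc,
        ← whisker_exchange_assoc, inr_twoJoin, whiskerLeft_snd, ← Category.assoc]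
      congr 1
      ext <;> simp

end ComplementedPower

/-! ## The free monoid -/

section FreeMonoid

variable [CartesianMonoidalCategory E]

/-- The `n`-fold product of `X` with itself. -/
noncomputable def npow (X : E) : ℕ → E
  | 0 => 𝟙_ E
  | n + 1 => X ⊗ npow X n

variable [HasCoproductsOfShape ℕ E]

/-- The underlying object `∑ n, X ^ n` of the free monoid on `X`. -/
noncomputable abbrev freeMon (X : E) : E := ∐ npow X

/-- The inclusion of the words of length `n`. -/
noncomputable def words (X : E) (n : ℕ) : npow X n ⟶ freeMon X := Sigma.ι (npow X) n

/-- The empty word. -/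
noncomputable def emptyWord (X : E) : 𝟙_ E ⟶ freeMon X := words X 0

/-- The inclusion of the words of length `n + 1`, with the first letter split off. -/
noncomputable def wordsSucc (X : E) (n : ℕ) : X ⊗ npow X n ⟶ freeMon X := words X (n + 1)

/-- The inclusion of generators, as the words of length one. -/
noncomputable def generators (X : E) : X ⟶ freeMon X :=
  lift (𝟙 X) (toUnit X) ≫ wordsSucc X 0

variable [MonoidalClosed E]

/-- Prepending a letter to a word. -/
noncomputable def consWord (X : E) : X ⊗ freeMon X ⟶ freeMon X :=
  uncurry (Sigma.desc fun n => curry (wordsSucc X n))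

/-- Prepending a word of length `n` to a word. -/
noncomputable def prependWord (X : E) : ∀ n, npow X n ⊗ freeMon X ⟶ freeMon X
  | 0 => (λ_ _).hom
  | n + 1 => (α_ X (npow X n) (freeMon X)).hom ≫ X ◁ prependWord X n ≫ consWord X

/-- Concatenation of words. -/
noncomputable def concat (X : E) : freeMon X ⊗ freeMon X ⟶ freeMon X :=
  sigmaTensorDesc (prependWord X)

lemma words_consWord (X : E) (n : ℕ) : X ◁ words X n ≫ consWord X = wordsSucc X n := by
  rw [consWord, ← uncurry_natural_left, words, Sigma.ι_desc, uncurry_curry]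

lemma words_concat (X : E) (n : ℕ) : words X n ▷ freeMon X ≫ concat X = prependWord X n :=
  ι_sigmaTensorDesc _ _

lemma wordsSucc_concat (X : E) (n : ℕ) : wordsSucc X n ▷ freeMon X ≫ concat X =
    (α_ X (npow X n) (freeMon X)).hom ≫ X ◁ prependWord X n ≫ consWord X :=
  words_concat X (n + 1)

lemma prependWord_emptyWord (X : E) (n : ℕ) :
    npow X n ◁ emptyWord X ≫ prependWord X n = (ρ_ (npow X n)).hom ≫ words X n := by
  induction n with
  | zero =>
    change 𝟙_ E ◁ emptyWord X ≫ (λ_ _).hom = (ρ_ (𝟙_ E)).hom ≫ emptyWord X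
    rw [leftUnitor_naturality, unitors_equal]
  | succ n ih =>
    change (X ⊗ npow X n) ◁ emptyWord X ≫
      (α_ X (npow X n) (freeMon X)).hom ≫ X ◁ prependWord X n ≫ consWord X =
        (ρ_ (X ⊗ npow X n)).hom ≫ wordsSucc X n
    rw [associator_naturality_right_assoc, ← whiskerLeft_comp_assoc, ih, whiskerLeft_comp_assoc,
      words_consWord, rightUnitor_tensor_hom, Category.assoc]

lemma consWord_concat (X : E) : consWord X ▷ freeMon X ≫ concat X =
    (α_ _ _ _).hom ≫ X ◁ concat X ≫ consWord X := by
  rw [← Iso.inv_comp_eq]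
  apply curry_injective
  apply sigmaTensor_ext
  intro n
  change words X n ▷ freeMon X ≫ _ = words X n ▷ freeMon X ≫ _
  rw [← curry_natural_left, ← curry_natural_left, associator_inv_naturality_middle_assoc,
    ← comp_whiskerRight_assoc, words_consWord, wordsSucc_concat, Iso.inv_hom_id_assoc,
    ← whiskerLeft_comp_assoc, words_concat]

lemma prependWord_concat (X : E) (n : ℕ) : prependWord X n ▷ freeMon X ≫ concat X =
    (α_ (npow X n) _ _).hom ≫ npow X n ◁ concat X ≫ prependWord X n := by
  induction n with
  | zero =>
    change (λ_ (freeMon X)).hom ▷ freeMon X ≫ concat X =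
      (α_ (𝟙_ E) _ _).hom ≫ 𝟙_ E ◁ concat X ≫ (λ_ _).hom
    simp
  | succ n ih =>
    change ((α_ X (npow X n) (freeMon X)).hom ≫ X ◁ prependWord X n ≫ consWord X) ▷ freeMon X ≫
      concat X = (α_ (X ⊗ npow X n) _ _).hom ≫ (X ⊗ npow X n) ◁ concat X ≫
        (α_ X (npow X n) (freeMon X)).hom ≫ X ◁ prependWord X n ≫ consWord X
    rw [comp_whiskerRight_assoc, comp_whiskerRight_assoc, consWord_concat,
      associator_naturality_middle_assoc, ← whiskerLeft_comp_assoc, ih,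
      associator_naturality_right_assoc]
    simp

/-- The free monoid on `X`: its multiplication is concatenation and its unit is the empty word. -/
noncomputable instance monObjFreeMon (X : E) : MonObj (freeMon X) where
  one := emptyWord X
  mul := concat X
  one_mul := words_concat X 0
  mul_one := by
    apply sigmaTensor_ext
    intro n
    change words X n ▷ 𝟙_ E ≫ _ = words X n ▷ 𝟙_ E ≫ _
    rw [← whisker_exchange_assoc, words_concat, prependWord_emptyWord, rightUnitor_naturality]
  mul_assoc := by
    rw [← Iso.inv_comp_eq]
    apply sigmaTensor_ext
    intro n
    change words X n ▷ (freeMon X ⊗ freeMon X) ≫ _ = words X n ▷ (freeMon X ⊗ freeMon X) ≫ _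
    rw [associator_inv_naturality_left_assoc, ← comp_whiskerRight_assoc, words_concat,
      prependWord_concat, Iso.inv_hom_id_assoc, ← whisker_exchange_assoc, words_concat]

end FreeMonoid

/-! ## The comparison map -/

section Comparison

variable [CartesianMonoidalCategory E] [MonoidalClosed E] [HasFiniteCoproducts E]
  [HasCoproductsOfShape ℕ E] [HasSubobjectClassifier E] [InitialMonoClass E]

/-- A map `κ : X* ⟶ 2 ^ X` is the comparison map of `X` if it is a map of monoids from the free
monoid to `(2 ^ X, ∨)` and extends the singleton map: the composite `X ⟶ X* ⟶ 2 ^ X ⟶ Ω ^ X` is the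
singleton map. -/
structure IsComparisonMap (X : E) (κ : freeMon X ⟶ pow (two E) X) : Prop where
  isMonHom : IsMonHom κ
  generators_comp : generators X ≫ κ ≫ powTwoToPowOmega X = singleton X

end Comparison

end ToposFinite

/-! The proof reasons with generalized elements, as one would with elements of sets. A property
holds `Locally` if it holds on a jointly epimorphic sieve. Equalities and factorizations through
subobjects can be checked locally (`Locally.eq`, `Locally.factors`), epimorphisms are the local
surjections, and joins of subobjects are local disjunctions (`sup_factors_iff`).

Everything then reduces to finite lists of generalized elements. Decidability says that equality on
`X` takes its truth values in `2`, so that the singleton map factors through the monomorphism `2 ^ X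
⟶ Ω ^ X` (`isDecidable_iff_singleton_lifts`). Existence and uniqueness of `κ` are then the universal
property of the free monoid.

The map `κ` sends a word to the set of its letters (`IsComparisonMap.wordOf_comp`), so its image in
`Ω ^ X` is the least join-submonoid containing the singletons. If `X` is also Kuratowski-finite, the
top element lies in this image, so locally over `1` some list exhausts `X`
(`IsKuratowskiFinite.locally_exhaustive`). Filtering such a list by a complemented subset shows that
`κ` is epi (`IsComparisonMap.epi`); conversely, if `κ` is epi, the top element is locally a join of
singletons.

Decidability also allows repetitions to be deleted locally. An exhaustive list of length `n` over
`U` with pairwise apart entries amounts to an isomorphism of `X × U` with `n × U` over `U`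
(`nonempty_iso_of_enumeration`, `exists_enumeration_of_iso`), which is local finiteness. -/

namespace ToposFinite

open HasSubobjectClassifier

/-! ### Subobjects through their generalized elements. -/

section Subobjects

variable {E : Type u} [Category.{w} E]

lemma mk_factors_iff_exists {T Y Z : E} (m : Z ⟶ Y) [Mono m] (f : T ⟶ Y) :
    (Subobject.mk m).Factors f ↔ ∃ k : T ⟶ Z, k ≫ m = f :=
  Subobject.mk_factors_iff m f

lemma subobject_ext {Y : E} {S R : Subobject Y}
    (h : ∀ ⦃A : E⦄ (f : A ⟶ Y), S.Factors f ↔ R.Factors f) : S = R :=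
  le_antisymm (Subobject.le_of_factors ((h _).1 S.factors_self))
    (Subobject.le_of_factors ((h _).2 R.factors_self))

lemma pullback_factors_iff [HasPullbacks E] {T Y Z : E} (S : Subobject Z) (g : Y ⟶ Z)
    (f : T ⟶ Y) : ((Subobject.pullback g).obj S).Factors f ↔ S.Factors (f ≫ g) := by
  constructor
  · intro h
    rw [← Subobject.factorThru_arrow _ f h, Category.assoc, ← (Subobject.isPullback g S).w,
      ← Category.assoc]
    exact Subobject.factors_comp_arrow _
  · intro h
    have := (Subobject.isPullback g S).lift_snd (S.factorThru _ h) f (by simp)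
    rw [← this]
    exact Subobject.factors_comp_arrow _

lemma exists_char_eq [HasSubobjectClassifier E] [HasPullbacks E] {T : E} (φ : T ⟶ Ω E) :
    ∃ S, char S = φ :=
  ⟨_, Subobject.Classifier.χ_pullback_obj_mk_truth_arrow _ φ⟩

end Subobjects

/-! ### Truth values of generalized elements. -/

section Omega

variable {E : Type u} [Category.{w} E] [CartesianMonoidalCategory E] [HasSubobjectClassifier E]

/-- The domain of `truth E` is terminal but need not be the chosen unit `𝟙_ E`; this reconciles the
two forms of the constant truth value. -/
lemma toUnit_comp_omegaTop (T : E) :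
    toUnit T ≫ omegaTop = Subobject.Classifier.χ₀ _ T ≫ truth E := by
  have h := comm (⊤ : Subobject (𝟙_ E)).arrow
  rw [← cancel_epi (inv (⊤ : Subobject (𝟙_ E)).arrow), IsIso.inv_hom_id_assoc] at h
  change toUnit T ≫ χ _ = _
  rw [h, ← Category.assoc, ← Category.assoc]
  congr 1
  exact Subsingleton.elim _ _

lemma comp_char_eq_top_iff {T Y : E} (S : Subobject Y) (f : T ⟶ Y) :
    f ≫ char S = toUnit T ≫ omegaTop ↔ S.Factors f := by
  rw [toUnit_comp_omegaTop, char]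
  constructor
  · intro h
    have := (isPullback_χ S.arrow).lift_fst f _ h
    rw [← this]
    exact Subobject.factors_comp_arrow _
  · intro h
    rw [← Subobject.factorThru_arrow S f h, Category.assoc, HasSubobjectClassifier.comm,
      ← Category.assoc]
    congr 1
    exact Subsingleton.elim _ _

/-- Both maps classify subobjects, and a subobject is determined by the generalized elements that
factor through it. -/
lemma omega_ext [HasPullbacks E] {T : E} {φ ψ : T ⟶ Ω E}
    (h : ∀ ⦃A : E⦄ (a : A ⟶ T), a ≫ φ = toUnit A ≫ omegaTop ↔ a ≫ ψ = toUnit A ≫ omegaTop) :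
    φ = ψ := by
  obtain ⟨S, rfl⟩ := exists_char_eq φ
  obtain ⟨R, rfl⟩ := exists_char_eq ψ
  congr 1
  exact subobject_ext fun A a => by rw [← comp_char_eq_top_iff, h, comp_char_eq_top_iff]

lemma mk_truth_factors_iff {T : E} (φ : T ⟶ Ω E) :
    (Subobject.mk (truth E)).Factors φ ↔ φ = toUnit T ≫ omegaTop := by
  rw [mk_factors_iff_exists, toUnit_comp_omegaTop]
  constructor
  · rintro ⟨k, rfl⟩
    congr 1
    exact Subsingleton.elim _ _
  · rintro rfl
    exact ⟨_, rfl⟩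

end Omega

/-! ### Local truth for jointly epimorphic sieves. -/

section Topology

variable {E : Type u} [Category.{w} E] [IsGrothendieckTopos.{w} E]

/-- A sieve is jointly epimorphic if no proper subobject contains it. -/
def IsJointlyEpi {T : E} (R : Sieve T) : Prop :=
  ∀ S : Subobject T, (∀ ⦃A : E⦄ (f : A ⟶ T), R f → S.Factors f) → S = ⊤

/-- Universal quantification of a subobject along a map. -/
lemma exists_forall_subobject {T T' : E} (g : T' ⟶ T) (S : Subobject T') :
    ∃ R : Subobject T, ∀ ⦃A : E⦄ (h : A ⟶ T), R.Factors h ↔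
      ∀ ⦃B : E⦄ (b : B ⟶ A) (k : B ⟶ T'), k ≫ g = b ≫ h → S.Factors k := by
  have hG : Mono (lift (𝟙 T') g) := mono_of_mono_fac (lift_fst _ _)
  have hH : Mono (lift S.arrow (S.arrow ≫ g)) := mono_of_mono_fac (lift_fst _ _)
  let G := Subobject.mk (lift (𝟙 T') g)
  let H := Subobject.mk (lift S.arrow (S.arrow ≫ g))
  have factG : ∀ {B : E} (k : B ⟶ T') (l : B ⟶ T), G.Factors (lift k l) ↔ k ≫ g = l := by
    intro B k l
    rw [mk_factors_iff_exists]
    constructor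
    · rintro ⟨m, hm⟩
      have h1 := congrArg (· ≫ fst _ _) hm
      have h2 := congrArg (· ≫ snd _ _) hm
      simp at h1 h2
      rw [← h1, h2]
    · rintro rfl
      refine ⟨k, ?_⟩
      simp
  have factH : ∀ {B : E} (k : B ⟶ T') (l : B ⟶ T),
      H.Factors (lift k l) ↔ S.Factors k ∧ k ≫ g = l := by
    intro B k l
    rw [mk_factors_iff_exists]
    constructor
    · rintro ⟨m, hm⟩
      have h1 := congrArg (· ≫ fst _ _) hm
      have h2 := congrArg (· ≫ snd _ _) hm
      simp at h1 h2
      refine ⟨?_, ?_⟩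
      · rw [← h1]; exact Subobject.factors_comp_arrow _
      · rw [← h1, ← h2, Category.assoc]
    · rintro ⟨h, rfl⟩
      refine ⟨S.factorThru k h, ?_⟩
      simp
  -- `G` is the graph of `g` and `H` its restriction to `S`. Their transposes `T ⟶ Ω ^ T'` send a
  -- point to its fibre and to the part of the fibre in `S`; the fibre lies in `S` exactly where the
  -- two agree.
  refine ⟨Subobject.mk (equalizer.ι (curry (char G)) (curry (char H))), fun A h => ?_⟩
  have h1 : (Subobject.mk (equalizer.ι (curry (char G)) (curry (char H)))).Factors h ↔
      T' ◁ h ≫ char G = T' ◁ h ≫ char H := by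
    rw [mk_factors_iff_exists, ← curry_injective.eq_iff, curry_natural_left,
      curry_natural_left]
    constructor
    · rintro ⟨m, hm⟩
      rw [← hm]
      rw [Category.assoc, equalizer.condition, Category.assoc]
    · intro hm
      exact ⟨equalizer.lift h hm, equalizer.lift_ι _ _⟩
  rw [h1]
  constructor
  · intro e B b k hk
    have := congrArg (lift k b ≫ ·) e
    simp only [lift_whiskerLeft_assoc] at this
    have h3 := (comp_char_eq_top_iff G (lift k (b ≫ h))).2 ((factG _ _).2 hk)
    rw [this, comp_char_eq_top_iff, factH] at h3
    exact h3.1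
  · intro e
    apply omega_ext
    intro B a
    have ha : a ≫ T' ◁ h = lift (a ≫ fst _ _) (a ≫ snd _ _ ≫ h) := by ext <;> simp
    rw [← Category.assoc, ← Category.assoc, comp_char_eq_top_iff, comp_char_eq_top_iff, ha,
      factG, factH]
    refine ⟨fun h4 => ⟨e (a ≫ snd _ _) _ (by simpa using h4), h4⟩, fun h4 => h4.2⟩

/-- If `S` contains the pulled-back sieve, then the universal quantification of `S` along `g`
contains `R`. It is therefore everything, and so is `S`. -/
lemma IsJointlyEpi.pullback {T T' : E} {R : Sieve T} (hR : IsJointlyEpi R) (g : T' ⟶ T) :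
    IsJointlyEpi (R.pullback g) := by
  intro S hS
  obtain ⟨Q, hQ⟩ := exists_forall_subobject g S
  have hQ' : Q = ⊤ := hR Q fun A f hf => by
    rw [hQ]
    intro B b k hk
    apply hS
    change R (k ≫ g)
    rw [hk]
    exact R.downward_closed hf b
  have h1 : Q.Factors (𝟙 T) := by rw [hQ']; exact Subobject.top_factors _
  rw [hQ] at h1
  rw [eq_top_iff]
  exact Subobject.le_of_factors (h1 (Subobject.arrow _ ≫ g) _ (by simp))

variable (E) in
/-- The topology of jointly epimorphic sieves. -/
def epiTopology : GrothendieckTopology E where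
  sieves _ := {R | IsJointlyEpi R}
  top_mem' T S hS := by
    rw [eq_top_iff]
    exact Subobject.le_of_factors (hS _ trivial)
  pullback_stable' _ _ _ g hR := hR.pullback g
  transitive' T R hR R' h S hS := hR S fun A f hf => by
    have := h hf ((Subobject.pullback f).obj S) fun B g hg => by
      rw [pullback_factors_iff]
      exact hS _ hg
    have h2 : ((Subobject.pullback f).obj S).Factors (𝟙 A) := by
      rw [this]; exact Subobject.top_factors _
    rw [pullback_factors_iff] at h2
    simpa using h2

/-- The property `P` of generalized elements of `T` holds on a jointly epimorphic sieve. -/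
def Locally (T : E) (P : ∀ ⦃A : E⦄, (A ⟶ T) → Prop) : Prop :=
  ∃ R ∈ epiTopology E T, ∀ ⦃A : E⦄ (f : A ⟶ T), R f → P f

variable {T : E} {P Q : ∀ ⦃A : E⦄, (A ⟶ T) → Prop}

lemma Locally.of_forall (h : ∀ ⦃A : E⦄ (f : A ⟶ T), P f) : Locally T P :=
  ⟨⊤, (epiTopology E).top_mem T, fun _ f _ => h f⟩

lemma Locally.imp (h : Locally T P) (hPQ : ∀ ⦃A : E⦄ (f : A ⟶ T), P f → Q f) : Locally T Q :=
  let ⟨R, hR, hP⟩ := h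
  ⟨R, hR, fun _ f hf => hPQ f (hP f hf)⟩

lemma Locally.comp (h : Locally T P) {B : E} (g : B ⟶ T) :
    Locally B fun _ f => P (f ≫ g) :=
  let ⟨_, hR, hP⟩ := h
  ⟨_, (epiTopology E).pullback_stable g hR, fun _ _ hf => hP _ hf⟩

lemma Locally.bind (h : Locally T P)
    (hPQ : ∀ ⦃A : E⦄ (f : A ⟶ T), P f → Locally A fun _ g => Q (g ≫ f)) : Locally T Q := by
  obtain ⟨R, hR, hP⟩ := h
  choose S hS hQ using fun A (f : A ⟶ T) (hf : R f) => hPQ f (hP f hf)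
  refine ⟨_, (epiTopology E).bind_covering hR fun A f hf => hS A f hf, ?_⟩
  rintro A _ ⟨B, g, f, hf, hg, rfl⟩
  exact hQ B f hf g hg

lemma Locally.factors {Y : E} {S : Subobject Y} {a : T ⟶ Y}
    (h : Locally T fun _ f => S.Factors (f ≫ a)) : S.Factors a := by
  obtain ⟨R, hR, hP⟩ := h
  have := hR ((Subobject.pullback a).obj S) fun A f hf => by
    rw [pullback_factors_iff]; exact hP f hf
  have h2 : ((Subobject.pullback a).obj S).Factors (𝟙 T) := by
    rw [this]; exact Subobject.top_factors _
  rw [pullback_factors_iff] at h2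
  simpa using h2

/-- Local lifts through a monomorphism are unique, so no compatibility condition is needed to glue
them. -/
lemma Locally.lift {Y Z : E} (m : Z ⟶ Y) [Mono m] {a : T ⟶ Y}
    (h : Locally T fun A f => ∃ k : A ⟶ Z, k ≫ m = f ≫ a) : ∃ k, k ≫ m = a := by
  have : (Subobject.mk m).Factors a :=
    Locally.factors (h.imp fun A f hf => (mk_factors_iff_exists m _).2 hf)
  exact (mk_factors_iff_exists m _).1 this

lemma Locally.eq {Y : E} {a b : T ⟶ Y} (h : Locally T fun _ f => f ≫ a = f ≫ b) : a = b := by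
  obtain ⟨k, hk⟩ := Locally.lift (equalizer.ι a b) (a := 𝟙 T)
    (h.imp fun A f hf => ⟨equalizer.lift f hf, by simp⟩)
  rw [← Category.id_comp a, ← Category.id_comp b, ← hk, Category.assoc, equalizer.condition,
    Category.assoc]

/-- The working criterion for covers: a subobject through which the identity factors is everything.
-/
lemma locally_of_factors {R : Sieve T}
    (h : ∀ S : Subobject T, (∀ ⦃A : E⦄ (f : A ⟶ T), R f → S.Factors f) → S.Factors (𝟙 T)) :
    Locally T fun _ f => R f :=
  ⟨R, fun S hS => eq_top_iff.2 (Subobject.le_of_factors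
    (by simpa using Subobject.factors_of_factors_right (Subobject.arrow _) (h S hS))),
    fun _ _ hf => hf⟩

/-- The inclusion of `S` is both mono and epi, and a topos is balanced. -/
lemma factors_id_of_epi {Y : E} (p : Y ⟶ T) [Epi p] {S : Subobject T} (h : S.Factors p) :
    S.Factors (𝟙 T) := by
  have : Epi S.arrow := epi_of_epi_fac (S.factorThru_arrow p h)
  have : IsIso S.arrow := isIso_of_mono_of_epi _
  rw [← IsIso.inv_hom_id S.arrow]
  exact Subobject.factors_comp_arrow _

lemma locally_of_epi {Y : E} (p : Y ⟶ T) [Epi p] :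
    Locally T fun A f => ∃ k : A ⟶ Y, k ≫ p = f :=
  locally_of_factors (R := ⟨fun A f => ∃ k : A ⟶ Y, k ≫ p = f, by
    rintro A B f ⟨k, rfl⟩ g; exact ⟨g ≫ k, by simp⟩⟩)
    fun _ hS => factors_id_of_epi p (hS p ⟨𝟙 _, by simp⟩)

lemma epi_of_locally {Y : E} (p : Y ⟶ T)
    (h : Locally T fun A f => ∃ k : A ⟶ Y, k ≫ p = f) : Epi p where
  left_cancellation a b hab := by
    apply Locally.eq
    refine h.imp ?_
    rintro A _ ⟨k, rfl⟩
    simp [hab]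

lemma locally_coproduct {I : Type*} (Z : I → E) [HasCoproduct Z] :
    Locally (∐ Z) fun A f => ∃ (i : I) (k : A ⟶ Z i), k ≫ Sigma.ι Z i = f := by
  refine locally_of_factors (R := ⟨fun A f => ∃ (i : I) (k : A ⟶ Z i), k ≫ Sigma.ι Z i = f, by
    rintro A B f ⟨i, k, rfl⟩ g; exact ⟨i, g ≫ k, by simp⟩⟩) fun S hS => ?_
  have h (i : I) : S.Factors (Sigma.ι Z i) := hS _ ⟨i, 𝟙 _, by simp⟩
  have : Sigma.desc (fun i => S.factorThru _ (h i)) ≫ S.arrow = 𝟙 _ := by ext; simp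
  rw [← this]
  exact Subobject.factors_comp_arrow _

lemma locally_coprod (Y Z : E) :
    Locally (Y ⨿ Z) fun A f =>
      (∃ k : A ⟶ Y, k ≫ coprod.inl = f) ∨ ∃ k : A ⟶ Z, k ≫ coprod.inr = f := by
  refine locally_of_factors (R := ⟨fun A f =>
      (∃ k : A ⟶ Y, k ≫ coprod.inl = f) ∨ ∃ k : A ⟶ Z, k ≫ coprod.inr = f, by
    rintro A B f (⟨k, rfl⟩ | ⟨k, rfl⟩) g
    exacts [.inl ⟨g ≫ k, by simp⟩, .inr ⟨g ≫ k, by simp⟩]⟩) fun S hS => ?_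
  have h1 : S.Factors (coprod.inl : Y ⟶ Y ⨿ Z) := hS _ (.inl ⟨𝟙 _, by simp⟩)
  have h2 : S.Factors (coprod.inr : Z ⟶ Y ⨿ Z) := hS _ (.inr ⟨𝟙 _, by simp⟩)
  have : coprod.desc (S.factorThru _ h1) (S.factorThru _ h2) ≫ S.arrow = 𝟙 _ := by ext <;> simp
  rw [← this]
  exact Subobject.factors_comp_arrow _

lemma sup_factors_iff {Y : E} (S R : Subobject Y) (a : T ⟶ Y) :
    (S ⊔ R).Factors a ↔ Locally T fun _ f => S.Factors (f ≫ a) ∨ R.Factors (f ≫ a) := by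
  constructor
  · intro h
    have key : Locally ((S ⊔ R : Subobject Y) : E) fun _ f =>
        S.Factors (f ≫ (S ⊔ R).arrow) ∨ R.Factors (f ≫ (S ⊔ R).arrow) := by
      refine locally_of_factors (R := ⟨fun _ f =>
        S.Factors (f ≫ (S ⊔ R).arrow) ∨ R.Factors (f ≫ (S ⊔ R).arrow), ?_⟩) fun Q hQ => ?_
      · rintro A B f (hf | hf) g
        · exact .inl (by simpa using Subobject.factors_of_factors_right g hf)
        · exact .inr (by simpa using Subobject.factors_of_factors_right g hf)
      -- Regarded as a subobject of `Y`, `Q` contains both `S` and `R`, hence their join; this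
      -- yields a section of `Q.arrow`.
      · have h1 : S ≤ Subobject.mk (Q.arrow ≫ (S ⊔ R).arrow) := by
          have := hQ (Subobject.ofLE S (S ⊔ R) le_sup_left) (.inl (by simpa using S.factors_self))
          refine Subobject.le_of_factors ((mk_factors_iff_exists _ _).2
            ⟨Q.factorThru _ this, ?_⟩)
          simp
        have h2 : R ≤ Subobject.mk (Q.arrow ≫ (S ⊔ R).arrow) := by
          have := hQ (Subobject.ofLE R (S ⊔ R) le_sup_right) (.inr (by simpa using R.factors_self))
          refine Subobject.le_of_factors ((mk_factors_iff_exists _ _).2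
            ⟨Q.factorThru _ this, ?_⟩)
          simp
        obtain ⟨k, hk⟩ := (mk_factors_iff_exists _ _).1
          (Subobject.factors_of_le _ (sup_le h1 h2) (Subobject.factors_self _))
        have : k ≫ Q.arrow = 𝟙 _ := by
          rw [← cancel_mono (S ⊔ R).arrow, Category.assoc, hk, Category.id_comp]
        rw [← this]
        exact Subobject.factors_comp_arrow _
    refine (key.comp ((S ⊔ R).factorThru a h)).imp fun A f hf => ?_
    simpa using hf
  · intro h
    refine Locally.factors (h.imp fun A f hf => ?_)
    rcases hf with hf | hf
    · exact Subobject.factors_of_le _ le_sup_left hf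
    · exact Subobject.factors_of_le _ le_sup_right hf

/-- An object covered by the empty sieve. -/
def IsVoid (T : E) : Prop := Locally T fun _ _ => False

lemma IsVoid.comp (h : IsVoid T) {B : E} (g : B ⟶ T) : IsVoid B := Locally.comp h g

lemma IsVoid.locally (h : IsVoid T) : Locally T P := Locally.imp h fun _ _ => False.elim

lemma IsVoid.eq (h : IsVoid T) {Y : E} (a b : T ⟶ Y) : a = b := Locally.eq h.locally

lemma bot_factors_iff {Y : E} (a : T ⟶ Y) : (⊥ : Subobject Y).Factors a ↔ IsVoid T := by
  constructor
  · intro h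
    have key : IsVoid ((⊥ : Subobject Y) : E) := by
      refine locally_of_factors (R := ⊥) fun S hS => ?_
      have : Subobject.botCoeIsoInitial.hom ≫ initial.to (S : E) ≫ S.arrow =
          𝟙 ((⊥ : Subobject Y) : E) := by
        rw [← cancel_epi Subobject.botCoeIsoInitial.inv]
        exact initialIsInitial.hom_ext _ _
      rw [← this, ← Category.assoc]
      exact Subobject.factors_comp_arrow _
    exact key.comp (Subobject.factorThru _ a h)
  · exact fun h => Locally.factors h.locally

end Topology

/-! ### The universal property of the free monoid. -/

section FreeMonoidLift

variable {E : Type u} [Category.{w} E] [CartesianMonoidalCategory E]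
  [HasCoproductsOfShape ℕ E] {X M : E} [MonObj M]

/-- The extension of a map into a monoid to the words of length `n`. -/
noncomputable def liftWord (f : X ⟶ M) : ∀ n, npow X n ⟶ M
  | 0 => MonObj.one
  | n + 1 => (f ⊗ₘ liftWord f n) ≫ MonObj.mul

/-- The extension of a map into a monoid to the free monoid. -/
noncomputable def freeMonLift (f : X ⟶ M) : freeMon X ⟶ M := Sigma.desc (liftWord f)

lemma words_freeMonLift (f : X ⟶ M) (n : ℕ) : words X n ≫ freeMonLift f = liftWord f n :=
  Sigma.ι_desc _ _

lemma generators_freeMonLift (f : X ⟶ M) : generators X ≫ freeMonLift f = f := by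
  refine (Category.assoc _ _ _).trans
    ((congrArg (lift (𝟙 X) (toUnit X) ≫ ·) (words_freeMonLift f 1)).trans ?_)
  change lift (𝟙 X) (toUnit X) ≫ (f ⊗ₘ MonObj.one) ≫ MonObj.mul = f
  rw [lift_map_assoc, Category.id_comp]
  exact MonObj.lift_comp_one_right _ _

variable [MonoidalClosed E]

lemma consWord_freeMonLift (f : X ⟶ M) :
    consWord X ≫ freeMonLift f = (f ⊗ₘ freeMonLift f) ≫ MonObj.mul := by
  apply tensorSigma_ext
  intro n
  change X ◁ words X n ≫ _ = X ◁ words X n ≫ _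
  rw [← Category.assoc, words_consWord, ← Category.assoc]
  refine (words_freeMonLift f (n + 1)).trans ?_
  change (f ⊗ₘ liftWord f n) ≫ _ = _
  rw [← words_freeMonLift]
  simp [tensorHom_def']

lemma prependWord_freeMonLift (f : X ⟶ M) (n : ℕ) :
    prependWord X n ≫ freeMonLift f = (liftWord f n ⊗ₘ freeMonLift f) ≫ MonObj.mul := by
  induction n with
  | zero =>
    change (λ_ _).hom ≫ _ = (MonObj.one ⊗ₘ _) ≫ _
    rw [tensorHom_def', Category.assoc, MonObj.one_mul, leftUnitor_naturality]
  | succ n ih =>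
    change ((α_ X (npow X n) (freeMon X)).hom ≫ X ◁ prependWord X n ≫ consWord X) ≫ _ =
      ((f ⊗ₘ liftWord f n) ≫ MonObj.mul ⊗ₘ freeMonLift f) ≫ MonObj.mul
    rw [Category.assoc, Category.assoc, consWord_freeMonLift, whiskerLeft_comp_tensorHom_assoc, ih]
    have h1 : ((f ⊗ₘ liftWord f n) ≫ MonObj.mul ⊗ₘ freeMonLift f) =
        ((f ⊗ₘ liftWord f n) ⊗ₘ freeMonLift f) ≫ MonObj.mul ▷ M :=
      (tensorHom_comp_whiskerRight _ _ _).symm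
    have h2 : (f ⊗ₘ (liftWord f n ⊗ₘ freeMonLift f) ≫ MonObj.mul) =
        (f ⊗ₘ (liftWord f n ⊗ₘ freeMonLift f)) ≫ M ◁ MonObj.mul :=
      (tensorHom_comp_whiskerLeft _ _ _).symm
    rw [h1, h2, Category.assoc, Category.assoc, MonObj.mul_assoc, associator_naturality_assoc]

instance isMonHom_freeMonLift (f : X ⟶ M) : IsMonHom (freeMonLift f) where
  one_hom := words_freeMonLift f 0
  mul_hom := by
    apply sigmaTensor_ext
    intro n
    change words X n ▷ _ ≫ concat X ≫ _ = words X n ▷ _ ≫ _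
    rw [← Category.assoc, words_concat, prependWord_freeMonLift, ← words_freeMonLift,
      ← Category.assoc, whiskerRight_comp_tensorHom]

/-- Prepending a letter is multiplication by a generator. Hence a map of monoids is determined on
words by induction on length, as used in `eq_freeMonLift`. -/
lemma generators_concat (X : E) : generators X ▷ freeMon X ≫ concat X = consWord X := by
  refine (comp_whiskerRight_assoc _ _ _ _).trans
    ((congrArg (lift (𝟙 X) (toUnit X) ▷ freeMon X ≫ ·) (wordsSucc_concat X 0)).trans ?_)
  change lift (𝟙 X) (toUnit X) ▷ freeMon X ≫ (α_ X (𝟙_ E) (freeMon X)).hom ≫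
    X ◁ (λ_ (freeMon X)).hom ≫ consWord X = _
  have : lift (𝟙 X) (toUnit X) ▷ freeMon X ≫ (α_ X (𝟙_ E) (freeMon X)).hom ≫
      X ◁ (λ_ (freeMon X)).hom = 𝟙 _ := by
    ext <;> simp
  rw [← Category.assoc, ← Category.assoc, Category.assoc _ _ (X ◁ _), this, Category.id_comp]

lemma consWord_comp (κ : freeMon X ⟶ M) [IsMonHom κ] :
    consWord X ≫ κ = ((generators X ≫ κ) ⊗ₘ κ) ≫ MonObj.mul := by
  rw [← generators_concat, Category.assoc]
  refine (congrArg (generators X ▷ freeMon X ≫ ·) (IsMonHom.mul_hom κ)).trans ?_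
  rw [← Category.assoc, whiskerRight_comp_tensorHom]

lemma eq_freeMonLift (f : X ⟶ M) (κ : freeMon X ⟶ M) [IsMonHom κ] (h : generators X ≫ κ = f) :
    κ = freeMonLift f := by
  apply Sigma.hom_ext
  intro n
  change words X n ≫ _ = words X n ≫ _
  rw [words_freeMonLift]
  induction n with
  | zero => exact IsMonHom.one_hom κ
  | succ n ih =>
    change wordsSucc X n ≫ κ = (f ⊗ₘ liftWord f n) ≫ MonObj.mul
    rw [← words_consWord, Category.assoc, consWord_comp, h, whiskerLeft_comp_tensorHom_assoc, ih]

end FreeMonoidLift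

/-! ### Membership in generalized elements of `Ω ^ X`. -/

section Membership

variable {E : Type u} [Category.{w} E] [IsGrothendieckTopos.{w} E] {X T : E}

lemma comp_eq_top {φ : T ⟶ Ω E} (h : φ = toUnit T ≫ omegaTop) {A : E} (a : A ⟶ T) :
    a ≫ φ = toUnit A ≫ omegaTop := by
  rw [h, ← Category.assoc, comp_toUnit]

lemma omegaBot_eq_top_iff : toUnit T ≫ omegaBot = toUnit T ≫ (omegaTop : _ ⟶ Ω E) ↔ IsVoid T := by
  rw [omegaBot, comp_char_eq_top_iff, bot_factors_iff]

lemma omegaJoin_eq_top_iff (φ ψ : T ⟶ Ω E) :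
    lift φ ψ ≫ omegaJoin = toUnit T ≫ omegaTop ↔
      Locally T fun A f => f ≫ φ = toUnit A ≫ omegaTop ∨ f ≫ ψ = toUnit A ≫ omegaTop := by
  rw [omegaJoin, comp_char_eq_top_iff, sup_factors_iff]
  simp only [pullback_factors_iff, mk_truth_factors_iff, Category.assoc, lift_fst, lift_snd]

/-- Membership of a generalized element of `X` in a generalized subobject of `X`. -/
def Mem (x : T ⟶ X) (g : T ⟶ pow (Ω E) X) : Prop :=
  lift x g ≫ eval (Ω E) X = toUnit T ≫ omegaTop

lemma lift_comp_curry {A : E} {Y : E} (x : A ⟶ X) (a : A ⟶ T) (φ : X ⊗ T ⟶ Y) :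
    lift x (a ≫ curry φ) ≫ eval Y X = lift x a ≫ φ := by
  rw [← lift_whiskerLeft_assoc, ← uncurry_eq, uncurry_curry]

lemma Mem.comp {x : T ⟶ X} {g : T ⟶ pow (Ω E) X} (h : Mem x g) {A : E} (a : A ⟶ T) :
    Mem (a ≫ x) (a ≫ g) := by
  have := comp_eq_top h a
  rwa [← Category.assoc, comp_lift] at this

lemma mem_of_locally {x : T ⟶ X} {g : T ⟶ pow (Ω E) X}
    (h : Locally T fun _ f => Mem (f ≫ x) (f ≫ g)) : Mem x g :=
  Locally.eq (h.imp fun A f hf => by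
    rw [← Category.assoc, comp_lift, ← Category.assoc, comp_toUnit]
    exact hf)

lemma pow_ext {g h : T ⟶ pow (Ω E) X}
    (H : ∀ ⦃A : E⦄ (a : A ⟶ T) (x : A ⟶ X), Mem x (a ≫ g) ↔ Mem x (a ≫ h)) : g = h := by
  apply uncurry_injective
  apply omega_ext
  intro A a
  have key (k : T ⟶ pow (Ω E) X) : a ≫ uncurry k =
      lift (a ≫ fst _ _) ((a ≫ snd _ _) ≫ k) ≫ eval (Ω E) X := by
    rw [← lift_whiskerLeft_assoc, ← uncurry_eq]
    congr 1
    ext <;> simp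
  rw [key, key]
  exact H _ _

lemma diagonal_factors_iff {x y : T ⟶ X} : (diagonal X).Factors (lift x y) ↔ x = y := by
  rw [diagonal, mk_factors_iff_exists]
  constructor
  · rintro ⟨k, hk⟩
    have h1 := congrArg (· ≫ fst _ _) hk
    have h2 := congrArg (· ≫ snd _ _) hk
    simp at h1 h2
    rw [← h1, h2]
  · rintro rfl
    exact ⟨x, by simp⟩

lemma mem_singleton_iff {x y : T ⟶ X} : Mem x (y ≫ singleton X) ↔ x = y := by
  rw [Mem, singleton, lift_comp_curry, comp_char_eq_top_iff, diagonal_factors_iff]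

lemma mem_bot_iff {x : T ⟶ X} {t : T ⟶ 𝟙_ E} : Mem x (t ≫ powConst X omegaBot) ↔ IsVoid T := by
  rw [Mem, powConst, lift_comp_curry, ← Category.assoc, comp_toUnit, omegaBot_eq_top_iff]

lemma mem_top {x : T ⟶ X} {t : T ⟶ 𝟙_ E} : Mem x (t ≫ powConst X omegaTop) := by
  rw [Mem, powConst, lift_comp_curry, ← Category.assoc, comp_toUnit]

lemma mem_join_iff {x : T ⟶ X} {g h : T ⟶ pow (Ω E) X} :
    Mem x (lift g h ≫ powMul X omegaJoin) ↔
      Locally T fun _ f => Mem (f ≫ x) (f ≫ g) ∨ Mem (f ≫ x) (f ≫ h) := by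
  have key : lift x (lift g h) ≫ lift (X ◁ fst _ _ ≫ eval (Ω E) X) (X ◁ snd _ _ ≫ eval (Ω E) X) =
      lift (lift x g ≫ eval (Ω E) X) (lift x h ≫ eval (Ω E) X) := by
    rw [comp_lift, lift_whiskerLeft_assoc, lift_whiskerLeft_assoc, lift_fst, lift_snd]
  rw [Mem, powMul, lift_comp_curry, ← Category.assoc, key, omegaJoin_eq_top_iff]
  simp only [← Category.assoc, comp_lift]
  rfl

end Membership

/-! ### The monomorphism `2 ⟶ Ω` and its compatibility with joins. -/

section Two

variable {E : Type u} [Category.{w} E] [IsGrothendieckTopos.{w} E] {X T : E}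

lemma locally_two (b : T ⟶ two E) : Locally T fun A f =>
    f ≫ b = toUnit A ≫ coprod.inl ∨ f ≫ b = toUnit A ≫ coprod.inr := by
  refine ((locally_coprod (𝟙_ E) (𝟙_ E)).comp b).imp ?_
  rintro A f (⟨k, hk⟩ | ⟨k, hk⟩)
  · exact .inl (by rw [← hk, toUnit_unique k (toUnit A)])
  · exact .inr (by rw [← hk, toUnit_unique k (toUnit A)])

lemma inl_twoToOmega : coprod.inl ≫ twoToOmega (E := E) = omegaTop := coprod.inl_desc _ _

lemma inr_twoToOmega : coprod.inr ≫ twoToOmega (E := E) = omegaBot := coprod.inr_desc _ _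

lemma isVoid_of_inl_eq_inr
    (h : toUnit T ≫ (coprod.inl : 𝟙_ E ⟶ two E) = toUnit T ≫ coprod.inr) : IsVoid T := by
  rw [← omegaBot_eq_top_iff, ← inl_twoToOmega, ← inr_twoToOmega, ← Category.assoc, ← h,
    Category.assoc]

/-- Locally both elements of `2` are one of the two constants. In the mixed cases equality in `Ω`
forces `⊥ = ⊤`, so the stage is void and any two maps out of it agree. -/
instance mono_twoToOmega : Mono (twoToOmega (E := E)) where
  right_cancellation {T} a b h := by
    refine Locally.eq ((locally_two a).bind fun A f hf => ((locally_two b).comp f).imp ?_)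
    intro B g hg
    have hab : (g ≫ f ≫ a) ≫ twoToOmega = (g ≫ f ≫ b) ≫ twoToOmega := by
      simp only [Category.assoc, h]
    replace hf : g ≫ f ≫ a = toUnit B ≫ coprod.inl ∨ g ≫ f ≫ a = toUnit B ≫ coprod.inr := by
      rcases hf with hf | hf
      · exact .inl (by rw [hf, ← Category.assoc, comp_toUnit])
      · exact .inr (by rw [hf, ← Category.assoc, comp_toUnit])
    simp only [Category.assoc] at hg ⊢
    rcases hf with hf | hf <;> rcases hg with hg | hg
    · rw [hf, hg]
    · rw [hf, hg, Category.assoc, Category.assoc, inl_twoToOmega, inr_twoToOmega] at hab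
      exact (omegaBot_eq_top_iff.1 hab.symm).eq _ _
    · rw [hf, hg, Category.assoc, Category.assoc, inl_twoToOmega, inr_twoToOmega] at hab
      exact (omegaBot_eq_top_iff.1 hab).eq _ _
    · rw [hf, hg]

lemma exists_comp_twoToOmega {φ : T ⟶ Ω E} (h : Locally T fun A f =>
    f ≫ φ = toUnit A ≫ omegaTop ∨ f ≫ φ = toUnit A ≫ omegaBot) : ∃ b, b ≫ twoToOmega = φ := by
  apply Locally.lift
  refine h.imp ?_
  rintro A f (hf | hf)
  · exact ⟨toUnit A ≫ coprod.inl, by rw [hf, Category.assoc, inl_twoToOmega]⟩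
  · exact ⟨toUnit A ≫ coprod.inr, by rw [hf, Category.assoc, inr_twoToOmega]⟩

lemma twoJoin_twoToOmega :
    twoJoin ≫ twoToOmega (E := E) = (twoToOmega ⊗ₘ twoToOmega) ≫ omegaJoin := by
  apply coprodTensor_ext
  · rw [← Category.assoc, inl_twoJoin, Category.assoc, inl_twoToOmega,
      whiskerRight_comp_tensorHom_assoc, inl_twoToOmega, eq_comm]
    have : (omegaTop ⊗ₘ twoToOmega (E := E)) = lift (fst _ _ ≫ omegaTop) (snd _ _ ≫ twoToOmega) := by
      ext <;> simp
    rw [this, omegaJoin_eq_top_iff]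
    refine .of_forall fun A f => .inl ?_
    simp only [← Category.assoc]
    congr 1
    exact toUnit_unique _ _
  · rw [← Category.assoc, inr_twoJoin, whiskerRight_comp_tensorHom_assoc, inr_twoToOmega]
    have : (omegaBot ⊗ₘ twoToOmega (E := E)) = lift (fst _ _ ≫ omegaBot) (snd _ _ ≫ twoToOmega) := by
      ext <;> simp
    rw [this]
    apply omega_ext
    intro A a
    rw [← Category.assoc a (lift _ _), comp_lift, omegaJoin_eq_top_iff]
    constructor
    · intro h
      exact .of_forall fun B f => .inr (comp_eq_top (by simpa using h) f)
    · intro h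
      refine Locally.eq (h.imp ?_)
      rintro B f (hf | hf)
      · have : IsVoid B := by
          rw [← omegaBot_eq_top_iff, ← hf]
          simp only [← Category.assoc]
          congr 1
          exact toUnit_unique _ _
        exact this.eq _ _
      · rw [← Category.assoc f (toUnit _), comp_toUnit, ← hf]

/-- Exponentiation is a right adjoint, so it preserves monomorphisms. Equalities in `2 ^ X` can
therefore be tested by membership in `Ω ^ X`. -/
instance mono_powTwoToPowOmega (X : E) : Mono (powTwoToPowOmega X) := by
  have : (ihom X).PreservesMonomorphisms :=
    Functor.preservesMonomorphisms_of_adjunction (ihom.adjunction X)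
  exact inferInstanceAs (Mono ((ihom X).map twoToOmega))

lemma one_powTwoToPowOmega (X : E) :
    (MonObj.one : 𝟙_ E ⟶ pow (two E) X) ≫ powTwoToPowOmega X = powConst X omegaBot := by
  change powConst X coprod.inr ≫ _ = _
  rw [powConst, powTwoToPowOmega, ← curry_natural_right, Category.assoc, inr_twoToOmega, powConst]

lemma mul_powTwoToPowOmega (X : E) :
    (MonObj.mul : _ ⟶ pow (two E) X) ≫ powTwoToPowOmega X =
      (powTwoToPowOmega X ⊗ₘ powTwoToPowOmega X) ≫ powMul X omegaJoin := by
  change powMul X twoJoin ≫ _ = _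
  rw [comp_powMul, powMul, powTwoToPowOmega, ← curry_natural_right, Category.assoc,
    twoJoin_twoToOmega, ← Category.assoc, lift_map, tensorHom_fst, tensorHom_snd,
    uncurry_natural_right, uncurry_natural_right, uncurry_eq, uncurry_eq]

lemma singleton_lifts (X : E) :
    (∃ s, s ≫ powTwoToPowOmega X = singleton X) ↔ ∃ b, b ≫ twoToOmega = char (diagonal X) := by
  constructor
  · rintro ⟨s, hs⟩
    refine ⟨uncurry s, ?_⟩
    rw [← uncurry_natural_right]
    change uncurry (s ≫ powTwoToPowOmega X) = _
    rw [hs, singleton, uncurry_curry]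
  · rintro ⟨b, hb⟩
    exact ⟨curry b, by rw [powTwoToPowOmega, ← curry_natural_right, hb, singleton]⟩

end Two

/-! ### Decidability as local equality or apartness. -/

section Decidable

variable {E : Type u} [Category.{w} E] [IsGrothendieckTopos.{w} E] {X T : E}

/-- Two generalized elements are apart if they agree only over the initial object. -/
def Apart (x y : T ⟶ X) : Prop := ∀ ⦃A : E⦄ (a : A ⟶ T), a ≫ x = a ≫ y → IsVoid A

lemma Apart.comp {x y : T ⟶ X} (h : Apart x y) {A : E} (a : A ⟶ T) : Apart (a ≫ x) (a ≫ y) :=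
  fun _ b hb => h (b ≫ a) (by simpa using hb)

lemma Apart.symm {x y : T ⟶ X} (h : Apart x y) : Apart y x := fun _ a ha => h a ha.symm

lemma Apart.char_eq {x y : T ⟶ X} (h : Apart x y) :
    lift x y ≫ char (diagonal X) = toUnit T ≫ omegaBot := by
  apply omega_ext
  intro A a
  rw [← Category.assoc, comp_char_eq_top_iff, comp_lift, diagonal_factors_iff, ← Category.assoc,
    comp_toUnit, omegaBot_eq_top_iff]
  exact ⟨fun hA => h a hA, fun hA => hA.eq _ _⟩

variable (X) in
lemma isDecidable_iff : IsDecidable X ↔ ∀ ⦃T : E⦄ (x y : T ⟶ X),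
    Locally T fun _ f => f ≫ x = f ≫ y ∨ Apart (f ≫ x) (f ≫ y) := by
  constructor
  · rintro ⟨S, hS⟩ T x y
    have h1 : (diagonal X ⊔ S).Factors (lift x y) := by
      rw [hS.sup_eq_top]; exact Subobject.top_factors _
    rw [sup_factors_iff] at h1
    refine h1.imp ?_
    intro A f hf
    rw [comp_lift, diagonal_factors_iff] at hf
    refine hf.imp id fun hf B b hb => ?_
    have h2 : (diagonal X ⊓ S).Factors (b ≫ lift (f ≫ x) (f ≫ y)) := by
      rw [Subobject.inf_factors]
      refine ⟨?_, Subobject.factors_of_factors_right b hf⟩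
      rw [comp_lift, diagonal_factors_iff, hb]
    rwa [hS.inf_eq_bot, bot_factors_iff] at h2
  · intro h
    -- The candidate complement is the negation of the diagonal: a pair lies in `N` when it meets
    -- the diagonal only over void stages.
    obtain ⟨N, hN⟩ := exists_forall_subobject (diagonal X).arrow ⊥
    refine ⟨N, IsCompl.of_eq ?_ ?_⟩
    · rw [eq_bot_iff]
      apply Subobject.le_of_factors
      have h1 := Subobject.factors_self (diagonal X ⊓ N)
      rw [Subobject.inf_factors, hN] at h1
      -- Factoring through `⊥` depends only on the stage, so the target may be changed from `X ⊗ X`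
      -- to the diagonal.
      rw [bot_factors_iff, ← bot_factors_iff (Subobject.factorThru _ _ h1.1)]
      exact h1.2 (𝟙 _) _ (by simp)
    · rw [eq_top_iff]
      apply Subobject.le_of_factors
      rw [sup_factors_iff]
      refine (h (Subobject.arrow ⊤ ≫ fst _ _) (Subobject.arrow ⊤ ≫ snd _ _)).imp ?_
      intro A f hf
      have h2 : f ≫ (⊤ : Subobject (X ⊗ X)).arrow =
          lift (f ≫ Subobject.arrow ⊤ ≫ fst _ _) (f ≫ Subobject.arrow ⊤ ≫ snd _ _) := by
        ext <;> simp
      rw [h2, diagonal_factors_iff, hN]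
      refine hf.imp id fun hf B b k hk => ?_
      rw [bot_factors_iff]
      refine hf b (diagonal_factors_iff.1 ?_)
      rw [← comp_lift, ← hk]
      exact Subobject.factors_comp_arrow _

/-- Transposing, the question is whether the characteristic map of the diagonal lands in `2`, that
is, whether it is locally `⊤` or `⊥`. -/
lemma isDecidable_iff_singleton_lifts (X : E) :
    IsDecidable X ↔ ∃ s, s ≫ powTwoToPowOmega X = singleton X := by
  rw [singleton_lifts]
  constructor
  · intro h
    apply exists_comp_twoToOmega
    refine ((isDecidable_iff X).1 h (fst X X) (snd X X)).imp fun A f hf => ?_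
    have h2 : f = lift (f ≫ fst _ _) (f ≫ snd _ _) := by ext <;> simp
    rw [h2, comp_char_eq_top_iff, diagonal_factors_iff]
    exact hf.imp id fun hf => hf.char_eq
  · rintro ⟨b, hb⟩
    rw [isDecidable_iff]
    intro T x y
    refine (locally_two (lift x y ≫ b)).imp ?_
    rintro A f (hf | hf)
    · left
      rw [← diagonal_factors_iff, ← comp_char_eq_top_iff, ← hb, ← comp_lift, Category.assoc,
        ← Category.assoc _ b, ← Category.assoc, hf, Category.assoc, inl_twoToOmega]
    · right
      intro B g hg
      rw [← diagonal_factors_iff, ← comp_char_eq_top_iff, ← hb, ← comp_lift, ← comp_lift,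
        Category.assoc, Category.assoc, ← Category.assoc _ b, ← Category.assoc f, hf,
        Category.assoc, inr_twoToOmega, ← Category.assoc, comp_toUnit, omegaBot_eq_top_iff] at hg
      exact hg

end Decidable

/-! ### Lists of generalized elements, as finite subsets and as words. -/

section Lists

variable {E : Type u} [Category.{w} E] [IsGrothendieckTopos.{w} E] {X T : E}

/-- The join of the singletons of a list of generalized elements. -/
noncomputable def joinList : List (T ⟶ X) → (T ⟶ pow (Ω E) X)
  | [] => toUnit T ≫ powConst X omegaBot
  | x :: l => lift (x ≫ singleton X) (joinList l) ≫ powMul X omegaJoin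

lemma mem_comp_joinList_iff (l : List (T ⟶ X)) {A : E} (a : A ⟶ T) (y : A ⟶ X) :
    Mem y (a ≫ joinList l) ↔ Locally A fun _ b => ∃ x ∈ l, b ≫ y = (b ≫ a) ≫ x := by
  induction l generalizing A with
  | nil =>
    rw [joinList, ← Category.assoc, mem_bot_iff]
    simp [IsVoid]
  | cons x l ih =>
    rw [joinList, ← Category.assoc, comp_lift, mem_join_iff]
    constructor
    · intro h
      refine h.bind ?_
      rintro B f (hf | hf)
      · rw [← Category.assoc, ← Category.assoc, mem_singleton_iff] at hf
        exact .of_forall fun C g => ⟨x, by simp, by rw [Category.assoc, hf]; simp⟩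
      · rw [← Category.assoc, ih] at hf
        refine hf.imp ?_
        rintro C g ⟨z, hz, h⟩
        exact ⟨z, by simp [hz], by simpa using h⟩
    · intro h
      refine h.imp ?_
      rintro B f ⟨z, hz, e⟩
      rw [List.mem_cons] at hz
      rcases hz with rfl | hz
      · left
        rw [← Category.assoc, ← Category.assoc, mem_singleton_iff, e]
      · right
        rw [← Category.assoc, ih]
        exact .of_forall fun C g => ⟨z, hz, by rw [e]; simp⟩

/-- A list of generalized elements of `X` is exhaustive if every generalized element of `X` is
locally a member of it. -/
def IsExhaustive (l : List (T ⟶ X)) : Prop :=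
  ∀ ⦃A : E⦄ (a : A ⟶ T) (y : A ⟶ X), Locally A fun _ b => ∃ x ∈ l, b ≫ y = (b ≫ a) ≫ x

lemma IsExhaustive.of_subset {l : List (T ⟶ X)} (h : IsExhaustive l) {A : E} {f : A ⟶ T}
    {l' : List (A ⟶ X)} (hl : ∀ x ∈ l, f ≫ x ∈ l') : IsExhaustive l' := by
  intro B a y
  refine (h (a ≫ f) y).imp ?_
  rintro C b ⟨x, hx, e⟩
  exact ⟨f ≫ x, hl x hx, by simpa using e⟩

lemma IsExhaustive.comp {l : List (T ⟶ X)} (h : IsExhaustive l) {A : E} (f : A ⟶ T) :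
    IsExhaustive (l.map (f ≫ ·)) :=
  h.of_subset fun x hx => List.mem_map.2 ⟨x, hx, rfl⟩

lemma pairwise_apart_comp {l : List (T ⟶ X)} (h : l.Pairwise Apart) {A : E} (f : A ⟶ T) :
    (l.map (f ≫ ·)).Pairwise Apart :=
  List.pairwise_map.2 (h.imp fun hx => hx.comp f)

lemma isExhaustive_iff (l : List (T ⟶ X)) :
    IsExhaustive l ↔ joinList l = toUnit T ≫ powConst X omegaTop := by
  constructor
  · intro h
    apply pow_ext
    intro A a y
    rw [mem_comp_joinList_iff, ← Category.assoc]
    exact ⟨fun _ => mem_top, fun _ => h a y⟩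
  · intro h A a y
    rw [← mem_comp_joinList_iff, h, ← Category.assoc]
    exact mem_top

lemma joinList_factors {S : Subobject (pow (Ω E) X)} (hS : IsJoinSubmonoid S)
    (h : S.Factors (singleton X)) (l : List (T ⟶ X)) : S.Factors (joinList l) := by
  induction l with
  | nil => exact Subobject.factors_of_factors_right _ hS.bot_mem
  | cons x l ih =>
    have hx : S.Factors (x ≫ singleton X) := Subobject.factors_of_factors_right _ h
    have := Subobject.factors_of_factors_right
      (lift (S.factorThru _ hx) (S.factorThru _ ih)) hS.join_mem
    rw [lift_map_assoc, Subobject.factorThru_arrow, Subobject.factorThru_arrow] at this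
    exact this

lemma imageSubobject_factors_self {Y : E} (p : T ⟶ Y) : (imageSubobject p).Factors p := by
  have := Subobject.factors_comp_arrow (factorThruImageSubobject p)
  rwa [imageSubobject_arrow_comp] at this

lemma finitePowerObj_factors_iff (g : T ⟶ pow (Ω E) X) :
    (finitePowerObj X).Factors g ↔
      ∀ S : Subobject (pow (Ω E) X), IsJoinSubmonoid S → S.Factors (singleton X) → S.Factors g := by
  constructor
  · intro h S hS hX
    exact Subobject.factors_of_le _ (Subobject.sInf_le.{w}
      {S | IsJoinSubmonoid S ∧ S.Factors (singleton X)} S ⟨hS, hX⟩) h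
  · intro h
    -- The universal property of the infimum concerns subobjects only, so `g` is replaced by its
    -- image.
    have h1 : imageSubobject g ≤ finitePowerObj X :=
      Subobject.le_sInf.{w} {S | IsJoinSubmonoid S ∧ S.Factors (singleton X)} _ fun S hS =>
        imageSubobject_le g (S.factorThru g (h S hS.1 hS.2)) (by simp)
    exact Subobject.factors_of_le _ h1 (imageSubobject_factors_self g)

/-- The word spelled by a list of generalized elements. -/
noncomputable def wordOf : List (T ⟶ X) → (T ⟶ freeMon X)
  | [] => toUnit T ≫ emptyWord X
  | x :: l => lift x (wordOf l) ≫ consWord X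

lemma exists_wordOf_eq (n : ℕ) (k : T ⟶ npow X n) : ∃ l, k ≫ words X n = wordOf l := by
  induction n with
  | zero => exact ⟨[], congrArg (· ≫ emptyWord X) (toUnit_unique k (toUnit T))⟩
  | succ n ih =>
    change T ⟶ X ⊗ npow X n at k
    obtain ⟨l, hl⟩ := ih (k ≫ snd X (npow X n))
    refine ⟨(k ≫ fst X (npow X n)) :: l, ?_⟩
    change k ≫ wordsSucc X n = _
    rw [wordOf, ← hl, ← words_consWord, ← Category.assoc]
    congr 1
    apply CartesianMonoidalCategory.hom_ext
    · rw [Category.assoc, whiskerLeft_fst, lift_fst]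
    · rw [Category.assoc, whiskerLeft_snd, lift_snd, Category.assoc]

/-- A sum is covered by its summands, so the length of a word is locally constant. -/
lemma locally_wordOf (v : T ⟶ freeMon X) :
    Locally T fun A f => ∃ l : List (A ⟶ X), f ≫ v = wordOf l := by
  refine ((locally_coproduct (npow X)).comp v).imp ?_
  rintro A f ⟨n, k, hk⟩
  obtain ⟨l, hl⟩ := exists_wordOf_eq n k
  exact ⟨l, hk.symm.trans hl⟩

end Lists

/-! ### The comparison map and Kuratowski-finiteness. -/

section Comparison

variable {E : Type u} [Category.{w} E] [IsGrothendieckTopos.{w} E] {X T : E}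

lemma isDecidable_of_comparison {κ : freeMon X ⟶ pow (two E) X} (hκ : IsComparisonMap X κ) :
    IsDecidable X :=
  (isDecidable_iff_singleton_lifts X).2
    ⟨generators X ≫ κ, by rw [Category.assoc]; exact hκ.generators_comp⟩

lemma existsUnique_comparison (hX : IsDecidable X) :
    ∃! κ : freeMon X ⟶ pow (two E) X, IsComparisonMap X κ := by
  obtain ⟨s, hs⟩ := (isDecidable_iff_singleton_lifts X).1 hX
  refine ⟨freeMonLift s, ⟨inferInstance, ?_⟩, fun κ hκ => ?_⟩
  · rw [← Category.assoc, generators_freeMonLift, hs]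
  · have := hκ.isMonHom
    apply eq_freeMonLift
    rw [← cancel_mono (powTwoToPowOmega X), hs, Category.assoc, hκ.generators_comp]

lemma IsComparisonMap.consWord_comp {κ : freeMon X ⟶ pow (two E) X} (hκ : IsComparisonMap X κ) :
    consWord X ≫ κ ≫ powTwoToPowOmega X =
      (singleton X ⊗ₘ (κ ≫ powTwoToPowOmega X)) ≫ powMul X omegaJoin := by
  have := hκ.isMonHom
  rw [← Category.assoc, ToposFinite.consWord_comp, Category.assoc, mul_powTwoToPowOmega,
    ← Category.assoc, tensorHom_comp_tensorHom, Category.assoc, hκ.generators_comp]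

lemma IsComparisonMap.wordOf_comp {κ : freeMon X ⟶ pow (two E) X} (hκ : IsComparisonMap X κ)
    (l : List (T ⟶ X)) : wordOf l ≫ κ ≫ powTwoToPowOmega X = joinList l := by
  have := hκ.isMonHom
  induction l with
  | nil =>
    rw [wordOf, joinList, Category.assoc, ← one_powTwoToPowOmega, ← IsMonHom.one_hom κ,
      Category.assoc]
    rfl
  | cons x l ih =>
    rw [wordOf, joinList, Category.assoc, hκ.consWord_comp, lift_map_assoc, ih]

lemma IsComparisonMap.comp_factors {κ : freeMon X ⟶ pow (two E) X} (hκ : IsComparisonMap X κ)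
    {S : Subobject (pow (Ω E) X)} (hS : IsJoinSubmonoid S) (h : S.Factors (singleton X)) :
    S.Factors (κ ≫ powTwoToPowOmega X) := by
  refine Locally.factors ((locally_wordOf (𝟙 (freeMon X))).imp ?_)
  rintro A f ⟨l, hl⟩
  rw [Category.comp_id] at hl
  rw [hl, hκ.wordOf_comp]
  exact joinList_factors hS h l

lemma powConst_inl_comp (X : E) : powConst X coprod.inl ≫ powTwoToPowOmega X =
    powConst X (omegaTop : 𝟙_ E ⟶ Ω E) := by
  rw [powConst, powTwoToPowOmega, ← curry_natural_right, Category.assoc, inl_twoToOmega, powConst]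

/-- The top element of `Ω ^ X` comes from `2 ^ X`, so it is locally in the image of `κ`, which every
join-submonoid containing the singletons contains. -/
lemma isKuratowskiFinite_of_epi {κ : freeMon X ⟶ pow (two E) X} (hκ : IsComparisonMap X κ)
    [Epi κ] : IsKuratowskiFinite X := by
  rw [IsKuratowskiFinite, finitePowerObj_factors_iff]
  intro S hS h
  rw [← powConst_inl_comp]
  apply Subobject.factors_of_factors_right
  apply Locally.factors
  refine (locally_of_epi κ).imp ?_
  rintro A _ ⟨k, rfl⟩
  rw [Category.assoc]
  exact Subobject.factors_of_factors_right _ (hκ.comp_factors hS h)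

lemma imageSubobject_factors_iff {Y Z : E} (p : Y ⟶ Z) (g : T ⟶ Z) :
    (imageSubobject p).Factors g ↔ Locally T fun A f => ∃ k : A ⟶ Y, k ≫ p = f ≫ g := by
  constructor
  · intro h
    refine ((locally_of_epi (factorThruImageSubobject p)).comp
      ((imageSubobject p).factorThru g h)).imp ?_
    rintro A f ⟨k, hk⟩
    refine ⟨k, ?_⟩
    rw [← imageSubobject_arrow_comp p, ← Category.assoc, hk, Category.assoc,
      Subobject.factorThru_arrow]
  · intro h
    refine Locally.factors (h.imp ?_)
    rintro A f ⟨k, hk⟩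
    rw [← hk]
    exact Subobject.factors_of_factors_right k (imageSubobject_factors_self p)

lemma IsComparisonMap.isJoinSubmonoid_image {κ : freeMon X ⟶ pow (two E) X}
    (hκ : IsComparisonMap X κ) :
    IsJoinSubmonoid (imageSubobject (κ ≫ powTwoToPowOmega X)) where
  bot_mem := by
    rw [imageSubobject_factors_iff]
    refine .of_forall fun A f => ⟨wordOf [], ?_⟩
    rw [hκ.wordOf_comp, joinList, toUnit_unique f (toUnit A)]
  join_mem := by
    have := hκ.isMonHom
    rw [imageSubobject_factors_iff]
    have key {T : E} (g : T ⟶ (imageSubobject (κ ≫ powTwoToPowOmega X) : E)) :=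
      (imageSubobject_factors_iff (κ ≫ powTwoToPowOmega X)
        (g ≫ (imageSubobject (κ ≫ powTwoToPowOmega X)).arrow)).1 (Subobject.factors_comp_arrow _)
    refine (key (fst _ _)).bind ?_
    rintro A f ⟨k, hk⟩
    refine ((key (snd _ _)).comp f).imp ?_
    rintro B g ⟨m, hm⟩
    refine ⟨lift (g ≫ k) m ≫ MonObj.mul, ?_⟩
    rw [Category.assoc, ← Category.assoc MonObj.mul, IsMonHom.mul_hom κ, Category.assoc,
      mul_powTwoToPowOmega, tensorHom_comp_tensorHom_assoc, lift_map_assoc, hm, Category.assoc, hk,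
      ← Category.assoc _ (_ ⊗ₘ _)]
    congr 1
    ext <;> simp

/-- The image of `κ` in `Ω ^ X` is a join-submonoid containing the singletons, so it contains the
top element. Locally the top element is thus the set of letters of a word. -/
lemma IsKuratowskiFinite.locally_exhaustive (h : IsKuratowskiFinite X) (hX : IsDecidable X) :
    Locally (𝟙_ E) fun A _ => ∃ l : List (A ⟶ X), IsExhaustive l := by
  obtain ⟨κ, hκ, -⟩ := existsUnique_comparison hX
  rw [IsKuratowskiFinite, finitePowerObj_factors_iff] at h
  have h1 := h _ hκ.isJoinSubmonoid_image <| by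
    rw [imageSubobject_factors_iff]
    exact .of_forall fun A f => ⟨f ≫ generators X, by rw [Category.assoc, hκ.generators_comp]⟩
  rw [imageSubobject_factors_iff] at h1
  refine h1.bind ?_
  rintro A f ⟨v, hv⟩
  refine (locally_wordOf v).imp ?_
  rintro B g ⟨l, hl⟩
  refine ⟨l, ?_⟩
  rw [isExhaustive_iff, ← hκ.wordOf_comp, ← hl, Category.assoc, hv, ← Category.assoc,
    toUnit_unique (g ≫ f) (toUnit B)]

lemma IsKuratowskiFinite.of_locally_exhaustive
    (h : Locally (𝟙_ E) fun A _ => ∃ l : List (A ⟶ X), IsExhaustive l) :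
    IsKuratowskiFinite X := by
  rw [IsKuratowskiFinite, finitePowerObj_factors_iff]
  intro S hS hX
  refine Locally.factors (h.imp ?_)
  rintro A f ⟨l, hl⟩
  rw [toUnit_unique f (toUnit A), ← (isExhaustive_iff l).1 hl]
  exact joinList_factors hS hX l

/-- A complemented subset has membership values in `2`, so excluded middle holds locally for it. -/
lemma locally_mem_or_not (g : T ⟶ pow (two E) X) (x : T ⟶ X) : Locally T fun A f =>
    Mem (f ≫ x) (f ≫ g ≫ powTwoToPowOmega X) ∨ ∀ ⦃B : E⦄ (b : B ⟶ A),
      Mem (b ≫ f ≫ x) (b ≫ f ≫ g ≫ powTwoToPowOmega X) → IsVoid B := by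
  have key {A : E} (f : A ⟶ T) : lift (f ≫ x) (f ≫ g ≫ powTwoToPowOmega X) ≫ eval (Ω E) X =
      f ≫ (lift x g ≫ eval (two E) X) ≫ twoToOmega := by
    have : powTwoToPowOmega X = (ihom X).map (twoToOmega (E := E)) := rfl
    rw [← comp_lift, Category.assoc, ← lift_whiskerLeft_assoc, ← uncurry_eq, this,
      uncurry_ihom_map, Category.assoc]
  refine (locally_two (lift x g ≫ eval (two E) X)).imp ?_
  rintro A f (hf | hf)
  · left
    rw [Mem, key, ← Category.assoc, hf, Category.assoc, inl_twoToOmega]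
  · right
    intro B b hb
    rw [← Category.assoc, ← Category.assoc b, Mem, key, Category.assoc, ← Category.assoc f, hf,
      Category.assoc, inr_twoToOmega, ← Category.assoc, comp_toUnit, omegaBot_eq_top_iff] at hb
    exact hb

lemma locally_filter (g : T ⟶ pow (two E) X) (l : List (T ⟶ X)) : Locally T fun A f =>
    ∃ l' : List (A ⟶ X), (∀ z ∈ l', Mem z (f ≫ g ≫ powTwoToPowOmega X)) ∧
      ∀ x ∈ l, f ≫ x ∈ l' ∨ ∀ ⦃B : E⦄ (b : B ⟶ A),
        Mem (b ≫ f ≫ x) (b ≫ f ≫ g ≫ powTwoToPowOmega X) → IsVoid B := by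
  induction l with
  | nil => exact .of_forall fun A f => ⟨[], by simp⟩
  | cons x l ih =>
    refine ih.bind ?_
    rintro A f ⟨l', h1, h2⟩
    refine (locally_mem_or_not (f ≫ g) (f ≫ x)).imp ?_
    intro B b hb
    have h1' : ∀ z ∈ l'.map (b ≫ ·), Mem z ((b ≫ f) ≫ g ≫ powTwoToPowOmega X) := by
      intro z hz
      obtain ⟨y, hy, rfl⟩ := List.mem_map.1 hz
      rw [Category.assoc]
      exact (h1 y hy).comp b
    have h2' : ∀ y ∈ l, (b ≫ f) ≫ y ∈ l'.map (b ≫ ·) ∨ ∀ ⦃C : E⦄ (c : C ⟶ B),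
        Mem (c ≫ (b ≫ f) ≫ y) (c ≫ (b ≫ f) ≫ g ≫ powTwoToPowOmega X) → IsVoid C := by
      intro y hy
      refine (h2 y hy).imp (fun h => List.mem_map.2 ⟨_, h, by simp⟩) fun h C c hc => ?_
      exact h (c ≫ b) (by simpa using hc)
    rcases hb with hb | hb
    · refine ⟨(b ≫ f ≫ x) :: l'.map (b ≫ ·), ?_, ?_⟩
      · intro z hz
        rcases List.mem_cons.1 hz with rfl | hz
        · simpa using hb
        · exact h1' z hz
      · intro y hy
        rcases List.mem_cons.1 hy with rfl | hy
        · left; simp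
        · exact (h2' y hy).imp (fun h => List.mem_cons_of_mem _ h) id
    · refine ⟨l'.map (b ≫ ·), h1', ?_⟩
      intro y hy
      rcases List.mem_cons.1 hy with rfl | hy
      · right
        intro C c hc
        exact hb c (by simpa using hc)
      · exact h2' y hy

/-- Given an element of `2 ^ X`, keep those entries of a local exhaustive list that belong to it;
the word they spell is a local preimage. -/
lemma IsComparisonMap.epi {κ : freeMon X ⟶ pow (two E) X} (hκ : IsComparisonMap X κ)
    (h : IsKuratowskiFinite X) : Epi κ := by
  apply epi_of_locally
  refine ((h.locally_exhaustive (isDecidable_of_comparison hκ)).comp (toUnit _)).bind ?_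
  rintro A f ⟨l, hl⟩
  refine (locally_filter f l).imp ?_
  rintro B b ⟨l', h1, h2⟩
  refine ⟨wordOf l', ?_⟩
  rw [← cancel_mono (powTwoToPowOmega X), Category.assoc, hκ.wordOf_comp]
  apply pow_ext
  intro C c y
  rw [mem_comp_joinList_iff]
  constructor
  · intro hy
    refine mem_of_locally (hy.imp ?_)
    rintro D d ⟨x, hx, e⟩
    rw [e]
    simpa using (h1 x hx).comp (d ≫ c)
  · intro hy
    refine (hl (c ≫ b) y).bind ?_
    rintro D d ⟨x, hx, e⟩
    -- If `x` was discarded, then `y`, which agrees with `x` here and belongs to the subset, forces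
    -- the stage to be void.
    rcases h2 x hx with h3 | h3
    · exact .of_forall fun F k => ⟨_, h3, by rw [Category.assoc, e]; simp⟩
    · refine IsVoid.locally (h3 (d ≫ c) ?_)
      have := hy.comp d
      rw [e] at this
      simpa using this

end Comparison

/-! ### Enumerations without repetition and local finiteness. -/

section LocallyFinite

variable {E : Type u} [Category.{w} E] [IsGrothendieckTopos.{w} E] {X T : E}

lemma locally_eq_or_apart (hX : IsDecidable X) (x : T ⟶ X) (l : List (T ⟶ X)) :
    Locally T fun _ f => (∃ z ∈ l, f ≫ x = f ≫ z) ∨ ∀ z ∈ l, Apart (f ≫ x) (f ≫ z) := by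
  induction l with
  | nil => exact .of_forall fun A f => by simp
  | cons z l ih =>
    refine ih.bind ?_
    rintro A f (⟨y, hy, h⟩ | h)
    · exact .of_forall fun B b => .inl ⟨y, by simp [hy], by rw [Category.assoc, h]; simp⟩
    · refine ((isDecidable_iff X).1 hX (f ≫ x) (f ≫ z)).imp ?_
      rintro B b (hb | hb)
      · exact .inl ⟨z, by simp, by simpa using hb⟩
      · right
        intro y hy
        rcases List.mem_cons.1 hy with rfl | hy
        · simpa using hb
        · simpa using (h y hy).comp b

/-- Entries are added one at a time: locally the new entry equals one already kept and is dropped,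
or is apart from all of them and is added. -/
lemma locally_dedup (hX : IsDecidable X) (l : List (T ⟶ X)) :
    Locally T fun A f => ∃ l' : List (A ⟶ X), l'.Pairwise Apart ∧ ∀ x ∈ l, f ≫ x ∈ l' := by
  induction l with
  | nil => exact .of_forall fun A f => ⟨[], by simp⟩
  | cons x l ih =>
    refine ih.bind ?_
    rintro A f ⟨l', h1, h2⟩
    refine (locally_eq_or_apart hX (f ≫ x) l').imp ?_
    intro B b hb
    have h2' : ∀ y ∈ l, (b ≫ f) ≫ y ∈ l'.map (b ≫ ·) := fun y hy =>
      List.mem_map.2 ⟨_, h2 y hy, by simp⟩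
    rcases hb with ⟨z, hz, e⟩ | hb
    · refine ⟨l'.map (b ≫ ·), pairwise_apart_comp h1 b, ?_⟩
      intro y hy
      rcases List.mem_cons.1 hy with rfl | hy
      · exact List.mem_map.2 ⟨z, hz, by simpa using e.symm⟩
      · exact h2' y hy
    · refine ⟨(b ≫ f ≫ x) :: l'.map (b ≫ ·), List.pairwise_cons.2
        ⟨?_, pairwise_apart_comp h1 b⟩, ?_⟩
      · intro y hy
        obtain ⟨z, hz, rfl⟩ := List.mem_map.1 hy
        exact hb z hz
      · intro y hy
        rcases List.mem_cons.1 hy with rfl | hy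
        · simp
        · exact List.mem_cons_of_mem _ (h2' y hy)

/-- A list of generalized elements over `T` that enumerates `X` without repetitions. -/
def IsEnumeration (l : List (T ⟶ X)) : Prop := l.Pairwise Apart ∧ IsExhaustive l

lemma locally_enumeration_iff : Locally (𝟙_ E) (fun A _ => ∃ l : List (A ⟶ X), IsEnumeration l) ↔
    IsDecidable X ∧ IsKuratowskiFinite X := by
  constructor
  · intro h
    refine ⟨?_, .of_locally_exhaustive (h.imp fun A _ ⟨l, hl⟩ => ⟨l, hl.2⟩)⟩
    rw [isDecidable_iff]
    intro T x y
    refine (h.comp (toUnit T)).bind ?_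
    rintro A f ⟨l, h1, h2⟩
    refine (h2 (𝟙 A) (f ≫ x)).bind ?_
    rintro B b ⟨x', hx', ex⟩
    refine (h2 b (b ≫ f ≫ y)).imp ?_
    rintro C c ⟨y', hy', ey⟩
    have ex' : (c ≫ b ≫ f) ≫ x = (c ≫ b) ≫ x' := by
      simpa using congrArg (c ≫ ·) ex
    have ey' : (c ≫ b ≫ f) ≫ y = (c ≫ b) ≫ y' := by simpa using ey
    simp only [Category.assoc] at ex' ey' ⊢
    rw [ex', ey']
    -- The case split is on equality of the list entries over `A`, not of their restrictions:
    -- distinct entries are apart by `h1`, whichever comes first.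
    by_cases e : x' = y'
    · exact .inl (by rw [e])
    · right
      have : Std.Symm (Apart (T := A) (X := X)) := ⟨fun _ _ h => h.symm⟩
      simpa using (h1.forall hx' hy' e).comp (c ≫ b)
  · rintro ⟨hX, hK⟩
    refine (hK.locally_exhaustive hX).bind ?_
    rintro A f ⟨l, hl⟩
    refine (locally_dedup hX l).imp ?_
    rintro B g ⟨l', h1, h2⟩
    exact ⟨l', h1, hl.of_subset h2⟩

/-- The generalized element of a constant object given by an element of the underlying set. -/
noncomputable def constElt (T : E) {S : Type w} (s : S) : T ⟶ constantObj S :=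
  toUnit T ≫ Sigma.ι (fun _ : S => 𝟙_ E) s

lemma comp_constElt {S : Type w} {A : E} (f : A ⟶ T) (s : S) : f ≫ constElt T s = constElt A s :=
  (Category.assoc _ _ _).symm.trans
    (congrArg (· ≫ Sigma.ι (fun _ : S => 𝟙_ E) s) (comp_toUnit f))

/-- The map out of a constant object given by a family of global elements. -/
noncomputable def constDesc {S : Type w} {Y : E} (y : S → (𝟙_ E ⟶ Y)) : constantObj S ⟶ Y :=
  Sigma.desc y

lemma constElt_constDesc {S : Type w} {Y : E} (y : S → (𝟙_ E ⟶ Y)) (s : S) :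
    constElt T s ≫ constDesc y = toUnit T ≫ y s :=
  (Category.assoc _ _ _).trans (congrArg (toUnit T ≫ ·) (Sigma.ι_desc _ _))

lemma locally_constantObj {S : Type w} (c : T ⟶ constantObj S) :
    Locally T fun A f => ∃ s : S, f ≫ c = constElt A s := by
  refine ((locally_coproduct fun _ : S => 𝟙_ E).comp c).imp ?_
  rintro A f ⟨s, k, hk⟩
  exact ⟨s, hk.symm.trans (congrArg (· ≫ Sigma.ι (fun _ : S => 𝟙_ E) s)
    (toUnit_unique k (toUnit A)))⟩

/-- The map to `2` that is `⊤` at `s` and `⊥` elsewhere separates the two summands. -/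
lemma isVoid_of_constElt_eq {S : Type w} {s t : S} (hst : s ≠ t)
    (h : constElt T s = constElt T t) : IsVoid T := by
  classical
  have := congrArg (· ≫ constDesc fun r : S =>
    if r = s then (coprod.inl : 𝟙_ E ⟶ two E) else coprod.inr) h
  simp only [constElt_constDesc, if_true, if_neg hst.symm] at this
  exact isVoid_of_inl_eq_inr this

lemma exists_enumeration_of_iso {U : E} {n : ℕ}
    (e : Over.mk (snd X U) ≅ Over.mk (snd (constantObj (ULift.{w} (Fin n))) U)) :
    ∃ l : List (U ⟶ X), IsEnumeration l := by
  obtain ⟨p, q, hpq, hqp, hp, hq⟩ : ∃ (p : X ⊗ U ⟶ constantObj (ULift.{w} (Fin n)) ⊗ U)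
      (q : constantObj (ULift.{w} (Fin n)) ⊗ U ⟶ X ⊗ U), p ≫ q = 𝟙 _ ∧ q ≫ p = 𝟙 _ ∧
      p ≫ snd _ _ = snd _ _ ∧ q ≫ snd _ _ = snd _ _ :=
    ⟨e.hom.left, e.inv.left, congrArg (·.left) e.hom_inv_id, congrArg (·.left) e.inv_hom_id,
      Over.w e.hom, Over.w e.inv⟩
  -- The entries are the images under `q` of the `n` constant sections over `U`.
  let x (i : Fin n) : U ⟶ X := lift (constElt U ⟨i⟩) (𝟙 U) ≫ q ≫ fst _ _
  have hx {A : E} (a : A ⟶ U) (i : Fin n) : lift (a ≫ x i) a =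
      lift (constElt A ⟨i⟩) a ≫ q := by
    apply CartesianMonoidalCategory.hom_ext
    · rw [lift_fst, ← Category.assoc a, comp_lift, comp_constElt, Category.comp_id, Category.assoc]
    · rw [lift_snd, Category.assoc, hq, lift_snd]
  refine ⟨List.ofFn x, List.pairwise_ofFn.2 ?_, ?_⟩
  · intro i j hij A a ha
    have h1 := hx a j
    rw [← ha, hx a i] at h1
    have h2 := congrArg (· ≫ p ≫ fst _ _) h1
    simp only [Category.assoc, reassoc_of% hqp, lift_fst] at h2
    exact isVoid_of_constElt_eq (fun h => hij.ne (ULift.up_injective h)) h2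
  · intro A a y
    refine (locally_constantObj (lift y a ≫ p ≫ fst _ _)).imp ?_
    rintro B b ⟨⟨i⟩, hb⟩
    refine ⟨x i, List.mem_ofFn.2 ⟨i, rfl⟩, ?_⟩
    have h1 : b ≫ lift y a ≫ p = lift (constElt B ⟨i⟩) (b ≫ a) := by
      apply CartesianMonoidalCategory.hom_ext
      · rw [lift_fst, ← hb]; simp
      · simp [hp]
    have h2 := congrArg (· ≫ q ≫ fst _ _) h1
    simp only [Category.assoc, reassoc_of% hpq, lift_fst] at h2
    rw [h2, ← Category.assoc _ q, ← hx, lift_fst]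

/-- The list defines a map from the constant object times `U` to `X ⊗ U`. Apartness of the entries
makes it mono, exhaustiveness makes it epi, and a topos is balanced. -/
lemma nonempty_iso_of_enumeration {U : E} {l : List (U ⟶ X)} (hl : IsEnumeration l) :
    Nonempty (Over.mk (snd X U) ≅
      Over.mk (snd (constantObj (ULift.{w} (Fin l.length))) U)) := by
  let S := ULift.{w} (Fin l.length)
  let d : constantObj S ⟶ pow X U :=
    constDesc fun s : S => curryLeft (snd (𝟙_ E) U ≫ l.get s.down)
  let m : constantObj S ⊗ U ⟶ X := uncurryLeft d
  have hm {A : E} (a : A ⟶ U) (s : S) : lift (constElt A s) a ≫ m = a ≫ l.get s.down := by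
    have h1 : lift (constElt A s) a = lift (𝟙 A) a ≫ constElt A s ▷ U := by
      ext <;> simp
    rw [h1, Category.assoc, whiskerRight_uncurryLeft, constElt_constDesc, ← whiskerRight_uncurryLeft,
      uncurryLeft_curryLeft, whiskerRight_snd_assoc, lift_snd_assoc]
  let p : constantObj S ⊗ U ⟶ X ⊗ U := lift m (snd _ _)
  have hmono : Mono p := by
    constructor
    intro A a b hab
    have e1 : a ≫ m = b ≫ m := by simpa [p] using congrArg (· ≫ fst _ _) hab
    have e2 : a ≫ snd _ _ = b ≫ snd _ _ := by simpa [p] using congrArg (· ≫ snd _ _) hab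
    refine Locally.eq ((locally_constantObj (a ≫ fst _ _)).bind ?_)
    rintro B f ⟨s, hs⟩
    refine (locally_constantObj (f ≫ b ≫ fst _ _)).bind ?_
    rintro C g ⟨t, ht⟩
    have ha : (g ≫ f) ≫ a = lift (constElt C s) ((g ≫ f) ≫ a ≫ snd _ _) := by
      apply CartesianMonoidalCategory.hom_ext
      · rw [lift_fst, Category.assoc, Category.assoc, hs, comp_constElt]
      · rw [lift_snd, Category.assoc]
    have hb : (g ≫ f) ≫ b = lift (constElt C t) ((g ≫ f) ≫ a ≫ snd _ _) := by
      apply CartesianMonoidalCategory.hom_ext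
      · rw [lift_fst, ← ht]; simp
      · rw [lift_snd, Category.assoc, e2]
    by_cases hst : s = t
    · have e3 : (g ≫ f) ≫ a = (g ≫ f) ≫ b := by rw [ha, hb, hst]
      exact .of_forall fun D k => by simpa using congrArg (k ≫ ·) e3
    · refine IsVoid.locally ?_
      have e3 : ((g ≫ f) ≫ a) ≫ m = ((g ≫ f) ≫ b) ≫ m := by
        rw [Category.assoc, e1, Category.assoc (g ≫ f) b]
      rw [ha, hb, hm, hm] at e3
      -- `List.Pairwise` gives apartness only for increasing indices, hence the two orders.
      rcases lt_or_gt_of_ne (fun h => hst (ULift.down_injective h) : s.down ≠ t.down) with h | h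
      · exact List.pairwise_iff_get.1 hl.1 _ _ h _ e3
      · exact List.pairwise_iff_get.1 hl.1 _ _ h _ e3.symm
  have hepi : Epi p := by
    apply epi_of_locally
    refine (hl.2 (snd X U) (fst X U)).imp ?_
    rintro A f ⟨x, hx, e⟩
    obtain ⟨i, rfl⟩ := List.get_of_mem hx
    refine ⟨lift (constElt A ⟨i⟩) (f ≫ snd _ _), ?_⟩
    apply CartesianMonoidalCategory.hom_ext
    · rw [Category.assoc, lift_fst, hm, e]
    · rw [Category.assoc, lift_snd, lift_snd]
  have : IsIso p := isIso_of_mono_of_epi p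
  exact ⟨(Over.isoMk (asIso p) (lift_snd _ _)).symm⟩

/-- A covering sieve may be large, whereas a cover is indexed by a set. One object satisfying `P` is
chosen for each subobject of `1` that is the image of such an object; these subobjects form a small
set, and objects with the same image in `1` cover the same part of it. -/
lemma exists_cover {P : E → Prop} (h : Locally (𝟙_ E) fun A _ => P A) :
    ∃ (I : Type w) (U : I → E), IsCover U ∧ ∀ i, P (U i) := by
  let J := {S : Subobject (𝟙_ E) // ∃ A, P A ∧ imageSubobject (toUnit A) = S}
  have : Small.{w} (Subobject (𝟙_ E)) := (IsGrothendieckTopos.wellPowered E).subobject_small _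
  choose U hP hU using fun i : Shrink.{w} J => ((equivShrink J).symm i).2
  refine ⟨Shrink.{w} J, U, ?_, hP⟩
  apply epi_of_locally
  refine h.bind fun A f hA => ?_
  let i := equivShrink J ⟨_, A, hA, rfl⟩
  have hi : imageSubobject (toUnit (U i)) = imageSubobject (toUnit A) := by
    rw [hU]; simp [i]
  have h1 : (imageSubobject (toUnit (U i))).Factors (toUnit A) := by
    rw [hi, imageSubobject_factors_iff]
    exact .of_forall fun B b => ⟨b, rfl⟩
  rw [imageSubobject_factors_iff] at h1
  refine h1.imp ?_
  rintro B b ⟨k, -⟩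
  exact ⟨k ≫ Sigma.ι U i, toUnit_unique _ _⟩

lemma isLocallyFinite_iff_locally_enumeration : IsLocallyFinite X ↔
    Locally (𝟙_ E) fun A _ => ∃ l : List (A ⟶ X), IsEnumeration l := by
  constructor
  · rintro ⟨I, U, hU, h⟩
    have : Epi (Sigma.desc fun i => toUnit (U i)) := hU
    refine (locally_of_epi (Sigma.desc fun i => toUnit (U i))).bind ?_
    rintro A _ ⟨k, rfl⟩
    refine ((locally_coproduct U).comp k).imp ?_
    rintro B _ ⟨i, m, -⟩
    obtain ⟨n, ⟨e⟩⟩ := h i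
    obtain ⟨l, hl⟩ := exists_enumeration_of_iso e
    exact ⟨_, pairwise_apart_comp hl.1 m, hl.2.comp m⟩
  · intro h
    obtain ⟨I, U, hU, hl⟩ := exists_cover h
    refine ⟨I, U, hU, fun i => ?_⟩
    obtain ⟨l, hl⟩ := hl i
    exact ⟨l.length, nonempty_iso_of_enumeration hl⟩

end LocallyFinite

end ToposFinite

/-! ### The three characterizations assembled. -/

theorem proposition3 {E : Type u} [Category.{w} E] [IsGrothendieckTopos.{w} E] (X : E) :
    (ToposFinite.IsLocallyFinite X ↔
      ToposFinite.IsDecidable X ∧ ToposFinite.IsKuratowskiFinite X) ∧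
    (ToposFinite.IsDecidable X →
      ∃! κ : ToposFinite.freeMon X ⟶ ToposFinite.pow (ToposFinite.two E) X,
        ToposFinite.IsComparisonMap X κ) ∧
    (ToposFinite.IsDecidable X ∧ ToposFinite.IsKuratowskiFinite X ↔
      ∃ κ : ToposFinite.freeMon X ⟶ ToposFinite.pow (ToposFinite.two E) X,
        ToposFinite.IsComparisonMap X κ ∧ Epi κ) := by
  refine ⟨ToposFinite.isLocallyFinite_iff_locally_enumeration.trans
    ToposFinite.locally_enumeration_iff, ToposFinite.existsUnique_comparison, ?_, ?_⟩
  · rintro ⟨hX, hK⟩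
    obtain ⟨κ, hκ, -⟩ := ToposFinite.existsUnique_comparison hX
    exact ⟨κ, hκ, hκ.epi hK⟩
  · rintro ⟨κ, hκ, h⟩
    exact ⟨ToposFinite.isDecidable_of_comparison hκ, ToposFinite.isKuratowskiFinite_of_epi hκ⟩
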